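/- Let $k\ge 1$ and $n\le -1$ be integers, and let $\mathcal K=J(k,2n)$ be the double twist knot, with knot group $$G(\mathcal K)=\langle a,b \mid w^n a=b w^n\rangle,\qquad w=\begin{cases}(ba^{-1})^m(b^{-1}a)^m & \text{if } k=2m,\\ (ba^{-1})^m\,ba\,(b^{-1}a)^m & \text{if } k=2m+1,\end{cases}$$ whose abelianization sends $a$ and $b$ to $t$. Let $\rho_0: G(\mathcal K)\to \mathrm{SL}_2(\mathbb C)$ be a holonomy representation, i.e. a representation with discrete image which induces a faithful representation into $\mathrm{PSL}_2(\mathbb C)$; if $k=1$ (when $\mathcal K$ is not hyperbolic), $\rho_0$ may instead be any non-abelian representation with $\operatorname{tr}\rho_0(a)=\pm 2$. Put $y=\operatorname{tr}\rho_0(ab^{-1})$ and $z=\operatorname{tr}\rho_0(w)$, and let $S_l$ ($l\in\mathbb Z$) be the Chebyshev polynomials defined by $S_0(v)=1$, $S_1(v)=v$, $S_l(v)=vS_{l-1}(v)-S_{l-2}(v)$. Let $\mathrm{Ad}$ be the adjoint action of $\mathrm{SL}_2(\mathbb C)$ on $\mathfrak{sl}_2(\mathbb C)$, let $\Phi:\mathbb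 Z[F(a,b)]\to M_3(\mathbb C[t^{\pm1}])$ be the ring homomorphism with $\Phi(a)=t\,\mathrm{Ad}(\rho_0(a))$ and $\Phi(b)=t\,\mathrm{Ad}(\rho_0(b))$, and let $$\Delta^{\mathrm{Ad}\circ\rho_0}_{\mathcal K}(t)=\frac{\det\Phi(\partial r/\partial a)}{\det\Phi(1-b)},\qquad r=w^naw^{-n}b^{-1},$$ where $\partial/\partial a$ is the Fox derivative. Then $\Delta^{\mathrm{Ad}\circ\rho_0}_{\mathcal K}(t)$ is a Laurent polynomial in $t$, and its highest and lowest degree terms are given by $$\Delta^{\mathrm{Ad}\circ\rho_0}_{\mathcal K}(t)=\begin{cases} c\,t^{0}+\dots-c\,t^{-3},\quad c=m|n|\,S_{m-1}(y)^2S_{|n|-1}(z)^2, & \text{if } k=2m,\\ -c\,t^{-3}+\dots+c\,t^{6n},\quad c=(m+1)\,S_m(y)^2, & \text{if } k=2m+1,\end{cases}$$ where $c\neq 0$ in both cases (and $c=1$ if $k=1$). -/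

import Mathlib

open scoped LaurentPolynomial MatrixGroups

noncomputable section

namespace DoubleTwist

/-! ### Fox calculus -/

section Fox

variable {α : Type} [DecidableEq α]

/-- Left multiplication by elements of `F = FreeGroup α` on the additive group of the group ring
`ℤ[F]`, written multiplicatively so that a semidirect product can be formed. -/
def leftAction :
    FreeGroup α →* MulAut (Multiplicative (MonoidAlgebra ℤ (FreeGroup α))) where
  toFun g := AddEquiv.toMultiplicative
    { toFun := fun x => MonoidAlgebra.of ℤ _ g * x
      invFun := fun x => MonoidAlgebra.of ℤ _ g⁻¹ * x
      left_inv := fun x => by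
        beta_reduce
        rw [← mul_assoc, ← map_mul, inv_mul_cancel, map_one, one_mul]
      right_inv := fun x => by
        beta_reduce
        rw [← mul_assoc, ← map_mul, mul_inv_cancel, map_one, one_mul]
      map_add' := fun x y => mul_add _ x y }
  map_one' := by
    ext x : 1
    change Multiplicative.ofAdd (MonoidAlgebra.of ℤ _ 1 * Multiplicative.toAdd x) = x
    rw [map_one, one_mul]; rfl
  map_mul' g h := by
    ext x : 1
    change Multiplicative.ofAdd (MonoidAlgebra.of ℤ _ (g * h) * Multiplicative.toAdd x) =
      Multiplicative.ofAdd
        (MonoidAlgebra.of ℤ _ g * (MonoidAlgebra.of ℤ _ h * Multiplicative.toAdd x))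
    rw [map_mul (MonoidAlgebra.of ℤ (FreeGroup α)), mul_assoc]

/-- The homomorphism `g ↦ (∂g/∂x, g)` into the semidirect product `ℤ[F] ⋊ F`. -/
def foxHom (x : α) : FreeGroup α →*
    Multiplicative (MonoidAlgebra ℤ (FreeGroup α)) ⋊[leftAction] FreeGroup α :=
  FreeGroup.lift fun y =>
    ⟨Multiplicative.ofAdd (if y = x then 1 else 0), FreeGroup.of y⟩

/-- The Fox derivative `∂g/∂x ∈ ℤ[F]` of a word `g`: the unique map with
`∂y/∂x = δ_{xy}` on generators and `∂(gh)/∂x = ∂g/∂x + g ∂h/∂x`. -/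
def foxDeriv (x : α) (g : FreeGroup α) : MonoidAlgebra ℤ (FreeGroup α) :=
  Multiplicative.toAdd (foxHom x g).left

theorem foxHom_right (x : α) (g : FreeGroup α) : (foxHom x g).right = g := by
  have h : SemidirectProduct.rightHom.comp (foxHom x) = MonoidHom.id (FreeGroup α) := by
    ext y
    simp [foxHom]
  exact DFunLike.congr_fun h g

theorem foxDeriv_of (x y : α) : foxDeriv x (FreeGroup.of y) = if y = x then 1 else 0 := by
  simp [foxDeriv, foxHom]

theorem foxDeriv_mul (x : α) (g h : FreeGroup α) :
    foxDeriv x (g * h) = foxDeriv x g + MonoidAlgebra.of ℤ _ g * foxDeriv x h := by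
  unfold foxDeriv
  rw [map_mul, SemidirectProduct.mul_left, foxHom_right, toAdd_mul]
  rfl

end Fox

/-! ### The knot group of the double twist knot `J(k, 2n)` -/

/-- The first generator of the free group of rank two. -/
def a : FreeGroup (Fin 2) := FreeGroup.of 0

/-- The second generator of the free group of rank two. -/
def b : FreeGroup (Fin 2) := FreeGroup.of 1

/-- The word `w`: `(ba⁻¹)^m (b⁻¹a)^m` if `k = 2m`, and `(ba⁻¹)^m ba (b⁻¹a)^m` if `k = 2m + 1`. -/
def w (k : ℕ) : FreeGroup (Fin 2) :=
  if Even k then (b * a⁻¹) ^ (k / 2) * (b⁻¹ * a) ^ (k / 2)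
  else (b * a⁻¹) ^ (k / 2) * (b * a) * (b⁻¹ * a) ^ (k / 2)

/-- The relator `r = wⁿ a w⁻ⁿ b⁻¹`. -/
def r (k : ℕ) (n : ℤ) : FreeGroup (Fin 2) := w k ^ n * a * w k ^ (-n) * b⁻¹

/-- The knot group `⟨a, b ∣ wⁿ a = b wⁿ⟩` of `J(k, 2n)`. -/
abbrev KnotGroup (k : ℕ) (n : ℤ) : Type := PresentedGroup ({r k n} : Set (FreeGroup (Fin 2)))

/-- The projection of the free group on `a, b` onto the knot group. -/
def proj (k : ℕ) (n : ℤ) : FreeGroup (Fin 2) →* KnotGroup k n := PresentedGroup.mk _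

/-- The abelianization of the knot group: both meridians `a`, `b` go to the generator of `ℤ`. -/
def abel (k : ℕ) (n : ℤ) : KnotGroup k n →* Multiplicative ℤ :=
  PresentedGroup.toGroup (f := fun _ : Fin 2 => Multiplicative.ofAdd (1 : ℤ)) (by
    intro s hs
    rw [Set.mem_singleton_iff] at hs
    subst hs
    simp [r, a, b, mul_comm])

/-! ### Twisted Alexander polynomials -/

variable {k : ℕ} {n : ℤ} {d : ℕ}

/-- The tensor product `ρ ⊗ 𝔞`, on group elements: `g ↦ t^{𝔞(g)} ρ(g)`. -/
def tensorRep (ρ : KnotGroup k n →* SL(d, ℂ)) :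
    KnotGroup k n →* Matrix (Fin d) (Fin d) ℂ[T;T⁻¹] where
  toFun g := (LaurentPolynomial.T (Multiplicative.toAdd (abel k n g)) : ℂ[T;T⁻¹]) •
    (ρ g : Matrix (Fin d) (Fin d) ℂ).map LaurentPolynomial.C
  map_one' := by
    simp
  map_mul' g h := by
    rw [map_mul (abel k n), map_mul ρ, toAdd_mul, LaurentPolynomial.T_add, Matrix.SpecialLinearGroup.coe_mul,
      Matrix.map_mul, smul_mul_smul_comm]

/-- The ring homomorphism `Φ : ℤ[F] → ℤ[G] → M_d(ℂ[t, t⁻¹])`. -/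
def Phi (ρ : KnotGroup k n →* SL(d, ℂ)) :
    MonoidAlgebra ℤ (FreeGroup (Fin 2)) →ₐ[ℤ] Matrix (Fin d) (Fin d) ℂ[T;T⁻¹] :=
  MonoidAlgebra.lift ℤ _ _ ((tensorRep ρ).comp (proj k n))

/-- The twisted Alexander polynomial
`Δ^ρ(t) = det Φ(∂r/∂a) / det Φ(1 - b)`, a rational function of `t`. -/
def twistedAlexander (ρ : KnotGroup k n →* SL(d, ℂ)) : FractionRing ℂ[T;T⁻¹] :=
  algebraMap ℂ[T;T⁻¹] _ (Phi ρ (foxDeriv 0 (r k n))).det /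
    algebraMap ℂ[T;T⁻¹] _ (Phi ρ (1 - MonoidAlgebra.of ℤ _ b)).det

/-! ### The adjoint representation -/

/-- The vector space `sl₂(ℂ)` of trace-zero `2 × 2` complex matrices. -/
abbrev sl2 : Submodule ℂ (Matrix (Fin 2) (Fin 2) ℂ) :=
  LinearMap.ker (Matrix.traceLinearMap (Fin 2) ℂ ℂ)

/-- Coordinates of a trace-zero matrix in the basis `E = [0 1; 0 0]`, `H = [1 0; 0 -1]`,
`F = [0 0; 1 0]`. -/
def sl2Coord : sl2 ≃ₗ[ℂ] (Fin 3 → ℂ) where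
  toFun X := ![X.1 0 1, X.1 0 0, X.1 1 0]
  invFun v := ⟨!![v 1, v 0; v 2, -v 1], by
    simp [Matrix.trace_fin_two]⟩
  map_add' X Y := by
    ext i; fin_cases i <;> simp
  map_smul' c X := by
    ext i; fin_cases i <;> simp
  left_inv X := by
    have h : Matrix.trace X.1 = 0 := X.2
    rw [Matrix.trace_fin_two] at h
    have h2 : X.1 1 1 = -X.1 0 0 := by linear_combination h
    apply Subtype.ext
    ext i j
    fin_cases i <;> fin_cases j <;> simp [h2]
  right_inv v := by
    ext i; fin_cases i <;> simp

/-- The basis `(E, H, F)` of `sl₂(ℂ)`. -/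
def sl2Basis : Module.Basis (Fin 3) ℂ sl2 := Module.Basis.ofEquivFun sl2Coord

/-- The adjoint action `Ad(V)(g) = V g V⁻¹` as a linear endomorphism of `sl₂(ℂ)`. -/
def Ad : SL(2, ℂ) →* Module.End ℂ sl2 where
  toFun V :=
    { toFun := fun X =>
        ⟨(V : Matrix (Fin 2) (Fin 2) ℂ) * X.1 * ((V⁻¹ : SL(2, ℂ)) : Matrix (Fin 2) (Fin 2) ℂ), by
          have h : Matrix.trace X.1 = 0 := X.2
          change Matrix.trace ((V : Matrix (Fin 2) (Fin 2) ℂ) * X.1 *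
            ((V⁻¹ : SL(2, ℂ)) : Matrix (Fin 2) (Fin 2) ℂ)) = 0
          rw [Matrix.trace_mul_comm, ← mul_assoc, ← Matrix.SpecialLinearGroup.coe_mul]
          simpa using h⟩
      map_add' := fun X Y => by
        apply Subtype.ext
        simp [mul_add, add_mul]
      map_smul' := fun c X => by
        apply Subtype.ext
        simp }
  map_one' := by
    ext X : 1
    apply Subtype.ext
    simp
  map_mul' V U := by
    ext X : 1
    apply Subtype.ext
    simp [mul_assoc]

/-- The explicit matrix of `Ad(V)` in the basis `(E, H, F)`. -/
theorem toMatrix_Ad (V : SL(2, ℂ)) : LinearMap.toMatrix sl2Basis sl2Basis (Ad V) =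
    !![V.1 0 0 ^ 2, -2 * V.1 0 0 * V.1 0 1, -V.1 0 1 ^ 2;
       -V.1 0 0 * V.1 1 0, V.1 0 0 * V.1 1 1 + V.1 0 1 * V.1 1 0, V.1 0 1 * V.1 1 1;
       -V.1 1 0 ^ 2, 2 * V.1 1 0 * V.1 1 1, V.1 1 1 ^ 2] := by
  have hb : ∀ j, (sl2Basis j) = sl2Coord.symm (Pi.single j 1) := fun j => by
    simp [sl2Basis, Module.Basis.coe_ofEquivFun]
  ext i j
  rw [LinearMap.toMatrix_apply, hb]
  change sl2Coord (Ad V (sl2Coord.symm (Pi.single j 1))) i = _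
  fin_cases i <;> fin_cases j <;>
    simp [sl2Coord, Ad, Matrix.SpecialLinearGroup.coe_inv, Matrix.adjugate_fin_two,
      Matrix.mul_apply, Fin.sum_univ_two] <;> ring

theorem det_toMatrix_Ad (V : SL(2, ℂ)) :
    (LinearMap.toMatrix sl2Basis sl2Basis (Ad V)).det = 1 := by
  have h : V.1 0 0 * V.1 1 1 - V.1 0 1 * V.1 1 0 = 1 := by
    rw [← Matrix.det_fin_two]; exact V.2
  rw [toMatrix_Ad, Matrix.det_fin_three]
  simp only [Matrix.of_apply, Matrix.cons_val', Matrix.cons_val_zero, Matrix.cons_val_one,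
    Matrix.cons_val]
  generalize V.1 0 0 = p at *
  generalize V.1 0 1 = q at *
  generalize V.1 1 0 = s at *
  generalize V.1 1 1 = u at *
  have h3 : (p * u - q * s) ^ 3 = 1 := by rw [h, one_pow]
  linear_combination h3

/-- The adjoint action in the basis `(E, H, F)`, as a homomorphism `SL₂(ℂ) → SL₃(ℂ)`. -/
def AdSL : SL(2, ℂ) →* SL(3, ℂ) where
  toFun V := ⟨LinearMap.toMatrix sl2Basis sl2Basis (Ad V), det_toMatrix_Ad V⟩
  map_one' := by
    apply Subtype.ext
    simp [LinearMap.toMatrix_one]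
  map_mul' V U := by
    apply Subtype.ext
    change LinearMap.toMatrix sl2Basis sl2Basis (Ad (V * U)) =
      LinearMap.toMatrix sl2Basis sl2Basis (Ad V) * LinearMap.toMatrix sl2Basis sl2Basis (Ad U)
    rw [map_mul]
    exact LinearMap.toMatrix_mul _ _ _

/-- The adjoint twisted Alexander polynomial `Δ^{Ad ∘ ρ}(t)` of `J(k, 2n)`. -/
def adjointTwistedAlexander (ρ : KnotGroup k n →* SL(2, ℂ)) : FractionRing ℂ[T;T⁻¹] :=
  twistedAlexander (AdSL.comp ρ)

/-! ### Classes of representations, and traces -/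

/-- `ρ` is a (lift to `SL₂(ℂ)` of a) holonomy representation: the induced representation into
`PSL₂(ℂ)` is faithful, and the image is discrete.  Since `SL₂(ℂ) → PSL₂(ℂ)` has finite central
kernel, the image in `SL₂(ℂ)` is discrete if and only if the image in `PSL₂(ℂ)` is. -/
structure IsHolonomy (ρ : KnotGroup k n →* SL(2, ℂ)) : Prop where
  faithful : Function.Injective
    ((QuotientGroup.mk' (Subgroup.center SL(2, ℂ))).comp ρ : KnotGroup k n →* PSL(2, ℂ))
  discrete : DiscreteTopology ρ.range

/-- `ρ` is non-abelian and sends meridians to matrices of trace `±2`. -/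
structure IsNonabelianParabolic (ρ : KnotGroup k n →* SL(2, ℂ)) : Prop where
  nonabelian : ∃ g h, ρ g * ρ h ≠ ρ h * ρ g
  trace_meridian : (ρ (proj k n a)).1.trace = 2 ∨ (ρ (proj k n a)).1.trace = -2

/-- `y = tr ρ(ab⁻¹)`. -/
def yTrace (ρ : KnotGroup k n →* SL(2, ℂ)) : ℂ := (ρ (proj k n (a * b⁻¹))).1.trace

/-- `z = tr ρ(w)`. -/
def zTrace (ρ : KnotGroup k n →* SL(2, ℂ)) : ℂ := (ρ (proj k n (w k))).1.trace

/-- The value `S_l(v)` of the Chebyshev polynomial with `S_0 = 1`, `S_1 = v`,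
`S_l = v S_{l-1} - S_{l-2}` for all integers `l`. -/
def S (l : ℤ) (v : ℂ) : ℂ := (Polynomial.Chebyshev.S ℂ l).eval v

/-- The rational function `Δ` is a Laurent polynomial whose highest degree term is `c t^hi`
and whose lowest degree term is `e t^lo`, where `c` and `e` are nonzero. -/
def HasExtremeTerms (Δ : FractionRing ℂ[T;T⁻¹]) (c : ℂ) (hi : ℤ) (e : ℂ) (lo : ℤ) : Prop :=
  ∃ P : ℂ[T;T⁻¹], algebraMap ℂ[T;T⁻¹] (FractionRing ℂ[T;T⁻¹]) P = Δ ∧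
    c ≠ 0 ∧ e ≠ 0 ∧ P.coeff hi = c ∧ P.coeff lo = e ∧
    ∀ i : ℤ, P.coeff i ≠ 0 → lo ≤ i ∧ i ≤ hi

end DoubleTwist

end

/-!
The Wada quotient is governed by the matrix `M = Φ(∂r/∂a)`.  Expanding `M` in powers of `t`, its
lowest and highest terms are, up to factors of determinant one, products of geometric sums
`∑ i < p, Ad(g) ^ i`, whose determinant is `p * S_{p-1}(tr g) ^ 2`.

Let the meridians be parabolic.  Then `det (1 - t Ad ρ(b)) = (1 - t) ^ 3`, and the fundamental
formula of Fox calculus gives `M (1 - t Ad ρ(a)) = M' (1 - t Ad ρ(b))`.  As `ρ(a)` and `ρ(b)` do not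
commute, this forces `(1 - t) ^ 3` to divide `det M`, so the quotient is a Laurent polynomial.  Its
extreme coefficients do not vanish: `S_{p-1}(tr g) = 0` forces `g ^ p = ±1`, which is incompatible
with the relations of the knot group when `ρ` is not abelian.

A holonomy representation has parabolic meridians.  Otherwise the images of the meridian and of the
longitude lie in a common torus, and discreteness yields a relation `μ ^ i λ ^ j = 1` in the knot
group.  No such relation exists: it fails in Riley's parabolic representation over
`ℤ[u] / (Riley polynomial)`, as one sees after reduction modulo 2.
-/

noncomputable section

namespace DoubleTwist

/-! ### Extreme coefficients of Laurent polynomials -/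

section LeadingTerm

open LaurentPolynomial

variable {R ι : Type*} [CommRing R]

/-- Substitution of `T^ε` for the variable of a polynomial; `ε = 1` and `ε = -1` are used to read
off lowest and highest degree terms respectively. -/
def substT (ε : ℤ) : Polynomial R →ₐ[R] R[T;T⁻¹] := Polynomial.aeval (T ε)

theorem substT_X (ε : ℤ) : substT ε (Polynomial.X : Polynomial R) = T ε := Polynomial.aeval_X _

theorem substT_C (ε : ℤ) (c : R) : substT ε (Polynomial.C c) = LaurentPolynomial.C c :=
  Polynomial.aeval_C _ _

theorem substT_monomial (ε : ℤ) (i : ℕ) (c : R) :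
    substT ε (Polynomial.monomial i c) = AddMonoidAlgebra.single (i * ε) c := by
  rw [← Polynomial.C_mul_X_pow_eq_monomial, map_mul, map_pow, substT_C, substT_X, T_pow,
    single_eq_C_mul_T]

theorem coeff_substT_zero {ε : ℤ} (hε : ε ≠ 0) (q : Polynomial R) :
    (substT ε q).coeff 0 = q.coeff 0 := by
  induction q using Polynomial.induction_on' with
  | add p q hp hq => simp [hp, hq]
  | monomial i c =>
    rw [substT_monomial, AddMonoidAlgebra.coeff_single, Finsupp.single_apply,
      Polynomial.coeff_monomial]
    simp [hε]

theorem coeff_substT_of_mul_neg {ε i : ℤ} (hi : ε * i < 0) (q : Polynomial R) :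
    (substT ε q).coeff i = 0 := by
  induction q using Polynomial.induction_on' with
  | add p q hp hq => simp [hp, hq]
  | monomial j c =>
    have hij : (j : ℤ) * ε ≠ i := by
      rintro rfl
      nlinarith [mul_nonneg (Int.natCast_nonneg j) (mul_self_nonneg ε)]
    rw [substT_monomial, AddMonoidAlgebra.coeff_single, Finsupp.single_eq_of_ne' hij]

theorem coeff_T_mul (e i : ℤ) (f : R[T;T⁻¹]) : (T e * f).coeff i = f.coeff (i - e) := by
  rw [T, AddMonoidAlgebra.coeff_single_mul_apply, one_mul, neg_add_eq_sub]

/-- `M = T^{εe} (E + T^ε E₁ + T^{2ε} E₂ + ⋯)`, a finite sum.  For `ε = 1` the matrix `E` is the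
coefficient of the lowest possible degree `e`, for `ε = -1` that of the highest possible
degree `-e`; it is allowed to vanish. -/
def HasLeadingTerm (ε e : ℤ) (M : Matrix ι ι R[T;T⁻¹]) (E : Matrix ι ι R) : Prop :=
  ∃ Q : Matrix ι ι (Polynomial R),
    M = (T (ε * e) : R[T;T⁻¹]) • Q.map (substT ε) ∧ Q.map (Polynomial.eval 0) = E

namespace HasLeadingTerm

variable {ε e e' : ℤ} {M M' : Matrix ι ι R[T;T⁻¹]} {E E' : Matrix ι ι R}

theorem T_smul_map_C (ε e : ℤ) (E : Matrix ι ι R) :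
    HasLeadingTerm ε e ((T (ε * e) : R[T;T⁻¹]) • E.map LaurentPolynomial.C) E :=
  ⟨E.map Polynomial.C, by ext1 i j; simp [substT_C], by ext1 i j; simp⟩

theorem add (h : HasLeadingTerm ε e M E) (h' : HasLeadingTerm ε e M' E') :
    HasLeadingTerm ε e (M + M') (E + E') := by
  obtain ⟨Q, rfl, rfl⟩ := h
  obtain ⟨Q', rfl, rfl⟩ := h'
  exact ⟨Q + Q', by ext1 i j; simp [mul_add], by ext1 i j; simp⟩

theorem neg (h : HasLeadingTerm ε e M E) : HasLeadingTerm ε e (-M) (-E) := by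
  obtain ⟨Q, rfl, rfl⟩ := h
  exact ⟨-Q, by ext1 i j; simp, by ext1 i j; simp⟩

theorem zero_of_lt (h : HasLeadingTerm ε e' M E) (he : e < e') : HasLeadingTerm ε e M 0 := by
  obtain ⟨Q, rfl, -⟩ := h
  obtain ⟨d, rfl⟩ := Int.exists_add_of_le he.le
  refine ⟨(Polynomial.X ^ d : Polynomial R) • Q, ?_, ?_⟩
  · ext1 i j
    simp only [Matrix.smul_apply, Matrix.map_apply, smul_eq_mul, map_mul, map_pow, substT_X, T_pow,
      ← mul_assoc, ← T_add]
    ring_nf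
  · ext1 i j
    simp [show d ≠ 0 by omega]

theorem add_of_lt (h : HasLeadingTerm ε e M E) (h' : HasLeadingTerm ε e' M' E') (he : e < e') :
    HasLeadingTerm ε e (M + M') E := by
  simpa using h.add (h'.zero_of_lt he)

theorem sum {κ : Type*} {s : Finset κ} {M : κ → Matrix ι ι R[T;T⁻¹]} {E : κ → Matrix ι ι R}
    (h : ∀ i ∈ s, HasLeadingTerm ε e (M i) (E i)) :
    HasLeadingTerm ε e (∑ i ∈ s, M i) (∑ i ∈ s, E i) := by
  classical
  induction s using Finset.induction_on with
  | empty => exact ⟨0, by ext1 i j; simp, by ext1 i j; simp⟩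
  | insert i s hi ih =>
    rw [Finset.sum_insert hi, Finset.sum_insert hi]
    exact (h i (by simp)).add (ih fun j hj => h j (Finset.mem_insert_of_mem hj))

theorem one [DecidableEq ι] : HasLeadingTerm ε 0 (1 : Matrix ι ι R[T;T⁻¹]) 1 := by
  simpa using T_smul_map_C ε 0 (1 : Matrix ι ι R)

variable [Fintype ι]

theorem mul (h : HasLeadingTerm ε e M E) (h' : HasLeadingTerm ε e' M' E') :
    HasLeadingTerm ε (e + e') (M * M') (E * E') := by
  obtain ⟨Q, rfl, rfl⟩ := h
  obtain ⟨Q', rfl, rfl⟩ := h'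
  refine ⟨Q * Q', ?_, Matrix.map_mul (f := Polynomial.evalRingHom 0)⟩
  rw [Matrix.map_mul, smul_mul_smul_comm, ← T_add, mul_add]

variable [DecidableEq ι]

theorem pow (h : HasLeadingTerm ε e M E) (p : ℕ) : HasLeadingTerm ε (p * e) (M ^ p) (E ^ p) := by
  induction p with
  | zero => simpa using one
  | succ p ih =>
    rw [pow_succ, pow_succ, Nat.cast_succ, add_one_mul]
    exact ih.mul h

theorem geom_sum_of_zero (h : HasLeadingTerm ε 0 M E) (p : ℕ) :
    HasLeadingTerm ε 0 (∑ i ∈ Finset.range p, M ^ i) (∑ i ∈ Finset.range p, E ^ i) :=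
  sum fun i _ => by simpa using h.pow i

theorem geom_sum_of_pos (h : HasLeadingTerm ε e M E) (he : 0 < e) (p : ℕ) :
    HasLeadingTerm ε 0 (∑ i ∈ Finset.range (p + 1), M ^ i) 1 := by
  induction p with
  | zero => simpa using one
  | succ p ih =>
    rw [Finset.sum_range_succ]
    exact ih.add_of_lt (h.pow (p + 1)) (by positivity)

theorem geom_sum_of_neg (h : HasLeadingTerm ε e M E) (he : e < 0) (p : ℕ) :
    HasLeadingTerm ε (p * e) (∑ i ∈ Finset.range (p + 1), M ^ i) (E ^ p) := by
  induction p with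
  | zero => simpa using one
  | succ p ih =>
    rw [Finset.sum_range_succ, add_comm (Finset.sum _ _)]
    exact (h.pow (p + 1)).add_of_lt ih (by push_cast; linarith)

theorem det_eq (h : HasLeadingTerm ε e M E) :
    ∃ q : Polynomial R, M.det = T (ε * (Fintype.card ι * e)) * substT ε q ∧
      q.coeff 0 = E.det := by
  obtain ⟨Q, rfl, rfl⟩ := h
  refine ⟨Q.det, ?_, ?_⟩
  · rw [Matrix.det_smul, T_pow, mul_left_comm]
    exact congrArg _ (AlgHom.map_det (substT ε) Q).symm
  · rw [Polynomial.coeff_zero_eq_eval_zero]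
    exact RingHom.map_det (Polynomial.evalRingHom 0) Q

theorem coeff_det (h : HasLeadingTerm ε e M E) (hε : ε ≠ 0) :
    M.det.coeff (ε * (Fintype.card ι * e)) = E.det := by
  obtain ⟨q, hq, hq0⟩ := h.det_eq
  rw [hq, coeff_T_mul, sub_self, coeff_substT_zero hε, hq0]

theorem coeff_det_of_lt (h : HasLeadingTerm ε e M E) (hε : IsUnit ε) {i : ℤ}
    (hi : ε * i < Fintype.card ι * e) : M.det.coeff i = 0 := by
  obtain ⟨q, hq, -⟩ := h.det_eq
  rw [hq, coeff_T_mul, coeff_substT_of_mul_neg]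
  rwa [mul_sub, ← mul_assoc, Int.isUnit_mul_self hε, one_mul, sub_neg]

end HasLeadingTerm

end LeadingTerm

section Division

open LaurentPolynomial

variable {R : Type*} [CommRing R]

theorem coeff_mul_one_sub_T (f : R[T;T⁻¹]) (i : ℤ) :
    (f * (1 - T 1)).coeff i = f.coeff i - f.coeff (i - 1) := by
  rw [mul_one_sub, mul_comm, AddMonoidAlgebra.coeff_sub, Finsupp.sub_apply, coeff_T_mul]

theorem eq_zero_of_finite_support_of_apply_sub_one {u : ℤ → R} (hu : u.support.Finite) {lo : ℤ}
    (h : ∀ i < lo, u (i - 1) = u i) {i : ℤ} (hi : i < lo) : u i = 0 := by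
  by_contra hne
  have hconst (j : ℕ) : u (i - j) = u i := by
    induction j with
    | zero => simp
    | succ j ih => rw [Nat.cast_succ, ← sub_sub, h _ (by omega), ih]
  refine Set.infinite_of_injective_forall_mem (f := fun j : ℕ => i - (j : ℤ))
    (fun _ _ h => by simpa using h) (fun j => ?_) hu
  rwa [Function.mem_support, hconst]

theorem coeff_of_mul_one_sub_T {f : R[T;T⁻¹]} {lo hi : ℤ}
    (h : ∀ i, (f * (1 - T 1)).coeff i ≠ 0 → lo ≤ i ∧ i ≤ hi + 1) :
    (∀ i, f.coeff i ≠ 0 → lo ≤ i ∧ i ≤ hi) ∧ f.coeff lo = (f * (1 - T 1)).coeff lo ∧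
      f.coeff hi = -(f * (1 - T 1)).coeff (hi + 1) := by
  have step (i : ℤ) (hi' : i < lo ∨ hi + 1 < i) : f.coeff (i - 1) = f.coeff i := by
    have := coeff_mul_one_sub_T f i
    rw [not_ne_iff.1 (mt (h i) (by omega))] at this
    exact (sub_eq_zero.1 this.symm).symm
  have hfin : (Function.support f.coeff).Finite := f.coeff.hasFiniteSupport
  have below (i : ℤ) (hlt : i < lo) : f.coeff i = 0 :=
    eq_zero_of_finite_support_of_apply_sub_one hfin (fun j hj => step j (.inl hj)) hlt
  have above (i : ℤ) (hlt : hi < i) : f.coeff i = 0 := by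
    have := eq_zero_of_finite_support_of_apply_sub_one (u := f.coeff ∘ Neg.neg) (lo := -hi)
      (hfin.preimage neg_injective.injOn)
      (fun j hj => by simpa [sub_eq_neg_add] using (step (1 - j) (by omega)).symm)
      (neg_lt_neg hlt)
    simpa using this
  refine ⟨fun i hi0 => ⟨not_lt.1 (mt (below i) hi0), not_lt.1 (mt (above i) hi0)⟩, ?_, ?_⟩
  · rw [coeff_mul_one_sub_T, below (lo - 1) (by omega), sub_zero]
  · rw [coeff_mul_one_sub_T, above (hi + 1) (by omega), add_sub_cancel_right, zero_sub, neg_neg]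

theorem coeff_of_mul_one_sub_T_pow (p : ℕ) {f : R[T;T⁻¹]} {lo hi : ℤ}
    (h : ∀ i, (f * (1 - T 1) ^ p).coeff i ≠ 0 → lo ≤ i ∧ i ≤ hi + p) :
    (∀ i, f.coeff i ≠ 0 → lo ≤ i ∧ i ≤ hi) ∧ f.coeff lo = (f * (1 - T 1) ^ p).coeff lo ∧
      f.coeff hi = (-1) ^ p * (f * (1 - T 1) ^ p).coeff (hi + p) := by
  induction p generalizing f hi with
  | zero => simpa using h
  | succ p ih =>
    rw [pow_succ', ← mul_assoc] at h ⊢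
    obtain ⟨hsupp, hlo, hhi⟩ := ih (f := f * (1 - T 1)) (hi := hi + 1)
      (by simpa only [Nat.cast_succ, add_right_comm, add_assoc] using h)
    obtain ⟨hsupp', hlo', hhi'⟩ := coeff_of_mul_one_sub_T hsupp
    refine ⟨hsupp', hlo'.trans hlo, ?_⟩
    rw [hhi', hhi, pow_succ', neg_one_mul, neg_mul, Nat.cast_succ, add_right_comm, add_assoc]

end Division

/-! ### The adjoint action of `SL₂(ℂ)` -/

section Conjugation

variable {ι R : Type*} [Fintype ι] [DecidableEq ι] [CommRing R]

open Matrix.SpecialLinearGroup in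
theorem trace_conj (g h : Matrix.SpecialLinearGroup ι R) :
    (h * g * h⁻¹).1.trace = g.1.trace := by
  rw [coe_mul, Matrix.trace_mul_comm, ← coe_mul, inv_mul_cancel_left]

theorem trace_inv (g : Matrix.SpecialLinearGroup (Fin 2) R) : (g⁻¹).1.trace = g.1.trace := by
  rw [Matrix.SpecialLinearGroup.coe_inv, Matrix.adjugate_fin_two]
  simp [Matrix.trace_fin_two, add_comm]

theorem entries_mul_sub_eq_one (g : Matrix.SpecialLinearGroup (Fin 2) R) :
    g.1 0 0 * g.1 1 1 - g.1 0 1 * g.1 1 0 = 1 := by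
  rw [← Matrix.det_fin_two, g.2]

theorem diag_pow_of_isUpperTriangular [LinearOrder ι] {M : Matrix ι ι R}
    (hM : M.IsUpperTriangular) (p : ℕ) (i : ι) : (M ^ p) i i = M i i ^ p := by
  induction p with
  | zero => simp
  | succ p ih =>
    rw [pow_succ, Matrix.mul_apply, pow_succ, ← ih]
    refine Finset.sum_eq_single i (fun j _ hj => ?_) (by simp)
    rcases hj.lt_or_gt with hj | hj
    · rw [(hM.pow p) hj, zero_mul]
    · rw [hM hj, mul_zero]

end Conjugation

section Adjoint

theorem coe_AdSL (V : SL(2, ℂ)) : (AdSL V).1 =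
    !![V.1 0 0 ^ 2, -2 * V.1 0 0 * V.1 0 1, -V.1 0 1 ^ 2;
       -V.1 0 0 * V.1 1 0, V.1 0 0 * V.1 1 1 + V.1 0 1 * V.1 1 0, V.1 0 1 * V.1 1 1;
       -V.1 1 0 ^ 2, 2 * V.1 1 0 * V.1 1 1, V.1 1 1 ^ 2] :=
  toMatrix_Ad V

theorem AdSL_mulVec_sl2Coord (V : SL(2, ℂ)) (X : sl2) :
    (AdSL V).1.mulVec (sl2Coord X) = sl2Coord (Ad V X) :=
  LinearMap.toMatrix_mulVec_repr sl2Basis sl2Basis (Ad V) X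

theorem S_add_one (l : ℤ) (v : ℂ) : S (l + 1) v = v * S l v - S (l - 1) v := by
  simp [S, Polynomial.Chebyshev.S_add_one]

theorem exists_ne_zero_add_inv_eq {K : Type*} [Field K] [IsAlgClosed K] (t : K) :
    ∃ s : K, s ≠ 0 ∧ s + s⁻¹ = t := by
  open Polynomial in
  obtain ⟨s, hs⟩ := IsAlgClosed.exists_root (X ^ 2 - C t * X + 1 : K[X]) (by
    have : (X ^ 2 - C t * X + 1 : K[X]).degree = 2 := by compute_degree!
    rw [this]; exact two_ne_zero)
  have hs : s ^ 2 - t * s + 1 = 0 := by simpa using hs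
  have hs0 : s ≠ 0 := by rintro rfl; simp at hs
  refine ⟨s, hs0, ?_⟩
  field_simp
  linear_combination hs

theorem exists_eq_conj_isUpperTriangular {K : Type*} [Field K] [IsAlgClosed K] (g : SL(2, K)) :
    ∃ h t : SL(2, K), g = h * t * h⁻¹ ∧ t.1 1 0 = 0 := by
  by_cases hg : g.1 1 0 = 0
  · exact ⟨1, g, by simp, hg⟩
  obtain ⟨s, hs, hst⟩ := exists_ne_zero_add_inv_eq (g.1 0 0 + g.1 1 1)
  have hchar : s * s - (g.1 0 0 + g.1 1 1) * s + 1 = 0 := by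
    rw [← hst]; field_simp; ring
  have hdet := entries_mul_sub_eq_one g
  -- The first column of `h` is an eigenvector of `g` for the eigenvalue `s`.
  let h : SL(2, K) := ⟨!![s - g.1 1 1, -(g.1 1 0)⁻¹; g.1 1 0, 0], by
    rw [Matrix.det_fin_two_of]; field_simp; ring⟩
  refine ⟨h, h⁻¹ * g * h, by group, ?_⟩
  rw [Matrix.SpecialLinearGroup.coe_mul, Matrix.SpecialLinearGroup.coe_mul,
    Matrix.SpecialLinearGroup.coe_inv, Matrix.adjugate_fin_two]
  simp only [h, Matrix.mul_apply, Fin.sum_univ_two, Matrix.of_apply, Matrix.cons_val',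
    Matrix.cons_val_zero, Matrix.cons_val_one, Matrix.cons_val_fin_one]
  linear_combination g.1 1 0 * hchar + g.1 1 0 * hdet

theorem pow_mul_S_add_inv {s : ℂ} (hs : s ≠ 0) (p : ℕ) :
    s ^ p * S ((p : ℤ) - 1) (s + s⁻¹) = s * ∑ i ∈ Finset.range p, (s ^ 2) ^ i := by
  induction p using Nat.twoStepInduction with
  | zero => simp [S]
  | one => simp [S]
  | more p ih₀ ih₁ =>
    have hrec : S ((p + 2 : ℕ) - 1 : ℤ) (s + s⁻¹) =
        (s + s⁻¹) * S ((p + 1 : ℕ) - 1 : ℤ) (s + s⁻¹) - S (p - 1 : ℤ) (s + s⁻¹) := by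
      rw [show ((p + 2 : ℕ) - 1 : ℤ) = p + 1 by push_cast; ring,
        show ((p + 1 : ℕ) - 1 : ℤ) = p by push_cast; ring, S_add_one]
    have hmul : s * s⁻¹ = 1 := mul_inv_cancel₀ hs
    rw [hrec]
    simp only [Finset.sum_range_succ] at ih₁ ⊢
    linear_combination (s ^ 2 + s * s⁻¹) * ih₁ - s ^ 2 * ih₀ +
      (s * ∑ i ∈ Finset.range p, (s ^ 2) ^ i + s * (s ^ 2) ^ p) * hmul

theorem det_geom_sum_AdSL_of_upper (t : SL(2, ℂ)) (ht : t.1 1 0 = 0) (p : ℕ) :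
    (∑ i ∈ Finset.range p, (AdSL t).1 ^ i).det = p * S ((p : ℤ) - 1) t.1.trace ^ 2 := by
  have hdet : t.1 0 0 * t.1 1 1 = 1 := by simpa [ht] using entries_mul_sub_eq_one t
  have hs : t.1 0 0 ≠ 0 := left_ne_zero_of_mul_eq_one hdet
  have hinv : t.1 1 1 = (t.1 0 0)⁻¹ := (inv_eq_of_mul_eq_one_right hdet).symm
  have hupper : (AdSL t).1.IsUpperTriangular := by
    intro i j hij
    fin_cases i <;> fin_cases j <;> simp_all [coe_AdSL]
  have hsum : (∑ i ∈ Finset.range p, (AdSL t).1 ^ i).IsUpperTriangular := by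
    intro i j hij
    rw [Matrix.sum_apply]
    exact Finset.sum_eq_zero fun l _ => hupper.pow l hij
  have h₁ := pow_mul_S_add_inv hs p
  have h₂ := pow_mul_S_add_inv (inv_ne_zero hs) p
  rw [inv_inv, add_comm] at h₂
  have hmul : t.1 0 0 * (t.1 0 0)⁻¹ = 1 := mul_inv_cancel₀ hs
  have hpow : t.1 0 0 ^ p * (t.1 0 0)⁻¹ ^ p = 1 := by rw [← mul_pow, hmul, one_pow]
  have hprod : (∑ i ∈ Finset.range p, (t.1 0 0 ^ 2) ^ i) *
      ∑ i ∈ Finset.range p, ((t.1 0 0)⁻¹ ^ 2) ^ i = S (p - 1 : ℤ) t.1.trace ^ 2 := by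
    rw [Matrix.trace_fin_two, hinv]
    generalize S (p - 1 : ℤ) _ = v at *
    generalize ∑ i ∈ Finset.range p, (t.1 0 0 ^ 2) ^ i = x at *
    generalize ∑ i ∈ Finset.range p, ((t.1 0 0)⁻¹ ^ 2) ^ i = y at *
    linear_combination v ^ 2 * hpow - x * y * hmul - t.1 0 0 ^ p * v * h₂ -
      (t.1 0 0)⁻¹ * y * h₁
  rw [Matrix.det_of_isUpperTriangular hsum, Fin.prod_univ_three, ← hprod]
  simp only [Matrix.sum_apply, diag_pow_of_isUpperTriangular hupper]
  have hdiag : (AdSL t).1 0 0 = t.1 0 0 ^ 2 ∧ (AdSL t).1 1 1 = 1 ∧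
      (AdSL t).1 2 2 = (t.1 0 0)⁻¹ ^ 2 := by simp [coe_AdSL, ht, hinv, hs]
  simp only [hdiag, one_pow, Finset.sum_const, Finset.card_range, nsmul_eq_mul, mul_one]
  ring

theorem det_geom_sum_AdSL (g : SL(2, ℂ)) (p : ℕ) :
    (∑ i ∈ Finset.range p, (AdSL g).1 ^ i).det = p * S ((p : ℤ) - 1) g.1.trace ^ 2 := by
  obtain ⟨h, t, rfl, ht⟩ := exists_eq_conj_isUpperTriangular g
  have hpow (i : ℕ) :
      (AdSL (h * t * h⁻¹)).1 ^ i = (AdSL h).1 * (AdSL t).1 ^ i * ((AdSL h)⁻¹).1 := by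
    simp only [← Matrix.SpecialLinearGroup.coe_pow, ← Matrix.SpecialLinearGroup.coe_mul, map_mul,
      map_inv, conj_pow]
  simp only [hpow, ← Finset.sum_mul, ← Finset.mul_sum, Matrix.det_mul, (AdSL h).det_coe,
    (AdSL h)⁻¹.det_coe, one_mul, mul_one, trace_conj, det_geom_sum_AdSL_of_upper t ht]

end Adjoint

section OneSub

open LaurentPolynomial

/-- The matrix `1 - t Ad(V)`. -/
def oneSubTAd (V : SL(2, ℂ)) : Matrix (Fin 3) (Fin 3) ℂ[T;T⁻¹] :=
  1 - (T 1 : ℂ[T;T⁻¹]) • (AdSL V).1.map C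

theorem det_oneSubTAd (V : SL(2, ℂ)) :
    (oneSubTAd V).det = (1 - T 1) * (1 - C (V.1.trace ^ 2 - 2) * T 1 + T 1 ^ 2) := by
  have hdet := congrArg (C : ℂ →+* ℂ[T;T⁻¹]) (entries_mul_sub_eq_one V)
  rw [oneSubTAd, coe_AdSL, Matrix.det_fin_three, Matrix.trace_fin_two]
  simp only [Fin.isValue, map_sub, map_mul, map_one, neg_mul, Matrix.sub_apply, Matrix.one_apply_eq,
    Matrix.smul_apply, Matrix.map_apply, Matrix.of_apply, Matrix.cons_val', Matrix.cons_val_zero,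
    Matrix.cons_val_fin_one, map_pow, smul_eq_mul, Matrix.cons_val_one, map_add, Matrix.cons_val,
    ne_eq, Fin.reduceEq, not_false_eq_true, Matrix.one_apply_ne, zero_sub, mul_neg, neg_neg,
    zero_ne_one, map_neg, sub_neg_eq_add, zero_add, one_ne_zero] at hdet ⊢
  generalize (C (V.1 0 0) : ℂ[T;T⁻¹]) = p at *
  generalize (C (V.1 0 1) : ℂ[T;T⁻¹]) = q at *
  generalize (C (V.1 1 0) : ℂ[T;T⁻¹]) = s at *
  generalize (C (V.1 1 1) : ℂ[T;T⁻¹]) = u at *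
  have h2 : (C 2 : ℂ[T;T⁻¹]) = 2 := map_ofNat C 2
  rw [h2]
  generalize (T 1 : ℂ[T;T⁻¹]) = x at *
  grind

theorem det_oneSubTAd_of_parabolic {V : SL(2, ℂ)} (hV : V.1.trace ^ 2 = 4) :
    (oneSubTAd V).det = (1 - T 1) ^ 3 := by
  have h2 : (C 2 : ℂ[T;T⁻¹]) = 2 := map_ofNat C 2
  rw [det_oneSubTAd, hV, show (4 - 2 : ℂ) = 2 by norm_num, h2]
  ring

/-- The trace-free part of a matrix. -/
def traceFree (V : SL(2, ℂ)) : sl2 := ⟨V.1 - (V.1.trace / 2) • 1, by simp⟩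

theorem sl2Coord_traceFree (V : SL(2, ℂ)) :
    sl2Coord (traceFree V) = ![V.1 0 1, (V.1 0 0 - V.1 1 1) / 2, V.1 1 0] := by
  ext i
  fin_cases i
  · simp [sl2Coord, traceFree]
  · change V.1 0 0 - (V.1.trace / 2) * 1 = _
    rw [Matrix.trace_fin_two]
    change _ = (V.1 0 0 - V.1 1 1) / 2
    ring
  · simp [sl2Coord, traceFree]

theorem adjugate_one_sub_AdSL {V : SL(2, ℂ)} (hV : V.1.trace ^ 2 = 4) :
    (1 - (AdSL V).1).adjugate = (-2 : ℂ) • Matrix.vecMulVec (sl2Coord (traceFree V))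
      ![V.1 1 0, V.1 0 0 - V.1 1 1, V.1 0 1] := by
  have hdet := entries_mul_sub_eq_one V
  rw [Matrix.trace_fin_two] at hV
  rw [coe_AdSL, Matrix.adjugate_fin_three, sl2Coord_traceFree]
  generalize V.1 0 0 = p at *
  generalize V.1 0 1 = q at *
  generalize V.1 1 0 = s at *
  generalize V.1 1 1 = u at *
  ext i j
  fin_cases i <;> fin_cases j <;> simp [Matrix.vecMulVec] <;> grind

theorem commute_of_traceFree_eq_zero {V V' : SL(2, ℂ)} (h : traceFree V' = 0) : Commute V V' := by
  have hV' : V'.1 = (V'.1.trace / 2) • 1 := sub_eq_zero.mp (congrArg Subtype.val h)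
  refine Subtype.ext ?_
  rw [Matrix.SpecialLinearGroup.coe_mul, Matrix.SpecialLinearGroup.coe_mul, hV']
  simp

theorem commute_of_Ad_traceFree {V V' : SL(2, ℂ)} (h : Ad V (traceFree V') = traceFree V') :
    Commute V V' := by
  have h : V.1 * (traceFree V').1 * (V⁻¹).1 = (traceFree V').1 := congrArg Subtype.val h
  have hcomm : V.1 * (traceFree V').1 = (traceFree V').1 * V.1 := by
    conv_rhs => rw [← h, mul_assoc, ← Matrix.SpecialLinearGroup.coe_mul, inv_mul_cancel]
    simp
  refine Subtype.ext ?_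
  simpa [traceFree, mul_sub, sub_mul] using hcomm

end OneSub

section Divisibility

open LaurentPolynomial

theorem pow_dvd_det_of_mul_eq {R ι : Type*} [CommRing R] [Fintype ι] [DecidableEq ι]
    {M M' N : Matrix ι ι R} {x : R} {p : ℕ} (h : M * N = x ^ p • M') {i j : ι}
    (hN : IsCoprime x (N i j)) : x ^ p ∣ M.det := by
  have hdet : M.det * N i j = x ^ p * (M.adjugate * M') i j := by
    rw [← smul_eq_mul, ← Matrix.smul_apply, ← smul_eq_mul (x ^ p), ← Matrix.smul_apply,
      ← Matrix.mul_smul, ← h, ← mul_assoc, Matrix.adjugate_mul, Matrix.smul_mul, one_mul]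
  exact hN.pow_left.dvd_of_dvd_mul_right (Dvd.intro _ hdet.symm)

theorem one_sub_T_dvd_one_sub_T {R : Type*} [CommRing R] (l : ℤ) :
    (1 - T 1 : R[T;T⁻¹]) ∣ 1 - T l := by
  obtain ⟨p, rfl | rfl⟩ := l.eq_nat_or_neg
  · rw [← mul_one (p : ℤ), ← T_pow]
    exact one_sub_dvd_one_sub_pow _ _
  · have h : (1 - T (-p) : R[T;T⁻¹]) = (1 - T 1 ^ p) * -T (-p) := by
      rw [T_pow, mul_one, sub_mul, mul_neg, mul_neg, ← T_add, add_neg_cancel,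
        T_zero]
      ring
    exact h ▸ (one_sub_dvd_one_sub_pow _ _).mul_right _

theorem isCoprime_one_sub_T {f : ℂ[T;T⁻¹]} (hf : eval₂ (RingHom.id ℂ) 1 f ≠ 0) :
    IsCoprime (1 - T 1) f := by
  have hdvd (g : ℂ[T;T⁻¹]) : (1 - T 1 : ℂ[T;T⁻¹]) ∣ C (eval₂ (RingHom.id ℂ) 1 g) - g := by
    induction g using LaurentPolynomial.induction_on' with
    | add p q hp hq => simpa [add_sub_add_comm] using dvd_add hp hq
    | C_mul_T l c =>
      simpa [mul_sub] using (one_sub_T_dvd_one_sub_T l).mul_left (C c)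
  obtain ⟨q, hq⟩ := hdvd f
  refine ⟨C (eval₂ (RingHom.id ℂ) 1 f)⁻¹ * q, C (eval₂ (RingHom.id ℂ) 1 f)⁻¹, ?_⟩
  have hC : (C (eval₂ (RingHom.id ℂ) 1 f)⁻¹ * C (eval₂ (RingHom.id ℂ) 1 f) : ℂ[T;T⁻¹]) = 1 := by
    rw [← map_mul, inv_mul_cancel₀ hf, map_one]
  linear_combination hC - C (eval₂ (RingHom.id ℂ) 1 f)⁻¹ * hq

theorem map_eval_oneSubTAd (V : SL(2, ℂ)) :
    (oneSubTAd V).map (eval₂ (RingHom.id ℂ) 1) = 1 - (AdSL V).1 := by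
  ext i j
  simp [oneSubTAd, Matrix.one_apply, apply_ite (eval₂ (RingHom.id ℂ) (1 : ℂˣ))]

theorem one_sub_AdSL_mul_adjugate_ne_zero {V V' : SL(2, ℂ)} (hcomm : ¬Commute V V')
    (hV' : V'.1.trace ^ 2 = 4) : (1 - (AdSL V).1) * (1 - (AdSL V').1).adjugate ≠ 0 := by
  rw [adjugate_one_sub_AdSL hV', Matrix.mul_smul, Matrix.mul_vecMulVec]
  refine smul_ne_zero (by norm_num) (Matrix.vecMulVec_ne_zero ?_ ?_)
  · refine mt (fun h => ?_) hcomm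
    rw [Matrix.sub_mulVec, Matrix.one_mulVec, AdSL_mulVec_sl2Coord, sub_eq_zero] at h
    exact commute_of_Ad_traceFree (sl2Coord.injective h.symm)
  · refine mt (fun h => commute_of_traceFree_eq_zero (sl2Coord.injective ?_)) hcomm
    have h₀ : V'.1 1 0 = 0 := congrFun h 0
    have h₁ : V'.1 0 0 - V'.1 1 1 = 0 := congrFun h 1
    have h₂ : V'.1 0 1 = 0 := congrFun h 2
    rw [sl2Coord_traceFree, h₀, h₁, h₂, map_zero, zero_div]
    simp

theorem one_sub_T_pow_three_dvd_det {V V' : SL(2, ℂ)} (hcomm : ¬Commute V V')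
    (hV' : V'.1.trace ^ 2 = 4) {M M' : Matrix (Fin 3) (Fin 3) ℂ[T;T⁻¹]}
    (h : M * oneSubTAd V = M' * oneSubTAd V') : (1 - T 1) ^ 3 ∣ M.det := by
  have hN : M * (oneSubTAd V * (oneSubTAd V').adjugate) = (1 - T 1 : ℂ[T;T⁻¹]) ^ 3 • M' := by
    rw [← mul_assoc, h, mul_assoc, Matrix.mul_adjugate, det_oneSubTAd_of_parabolic hV',
      Matrix.mul_smul, mul_one]
  have hmap : (oneSubTAd V * (oneSubTAd V').adjugate).map (eval₂ (RingHom.id ℂ) 1) =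
      (1 - (AdSL V).1) * (1 - (AdSL V').1).adjugate := by
    rw [Matrix.map_mul, ← RingHom.mapMatrix_apply _ (Matrix.adjugate _), RingHom.map_adjugate,
      RingHom.mapMatrix_apply, map_eval_oneSubTAd, map_eval_oneSubTAd]
  obtain ⟨i, j, hij⟩ : ∃ i j,
      eval₂ (RingHom.id ℂ) 1 ((oneSubTAd V * (oneSubTAd V').adjugate) i j) ≠ 0 := by
    by_contra! h₀
    exact one_sub_AdSL_mul_adjugate_ne_zero hcomm hV' (hmap ▸ Matrix.ext h₀)
  exact pow_dvd_det_of_mul_eq hN (isCoprime_one_sub_T hij)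

end Divisibility

/-! ### The Fox derivative of the relator -/

section FoxCalculus

open MonoidAlgebra (of)

variable {α : Type} [DecidableEq α]

theorem foxDeriv_one (x : α) : foxDeriv x 1 = 0 := by
  have h := foxDeriv_mul x 1 1
  rw [map_one, one_mul, one_mul] at h
  exact left_eq_add.mp h

theorem foxDeriv_inv (x : α) (g : FreeGroup α) :
    foxDeriv x g⁻¹ = -(of ℤ _ g⁻¹ * foxDeriv x g) := by
  have h := foxDeriv_mul x g⁻¹ g
  rw [inv_mul_cancel, foxDeriv_one] at h
  exact eq_neg_of_add_eq_zero_left h.symm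

theorem foxDeriv_pow (x : α) (g : FreeGroup α) (p : ℕ) :
    foxDeriv x (g ^ p) = (∑ i ∈ Finset.range p, of ℤ _ g ^ i) * foxDeriv x g := by
  induction p with
  | zero => simp [foxDeriv_one]
  | succ p ih => rw [pow_succ, foxDeriv_mul, ih, Finset.sum_range_succ, add_mul, map_pow]

theorem foxDeriv_conj (x : α) (g h : FreeGroup α) :
    foxDeriv x (g * h * g⁻¹) =
      of ℤ _ g * foxDeriv x h + (1 - of ℤ _ (g * h * g⁻¹)) * foxDeriv x g := by
  rw [foxDeriv_mul, foxDeriv_mul, foxDeriv_inv, map_mul _ (g * h)]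
  noncomm_ring

theorem sum_foxDeriv_mul_of_sub_one [Fintype α] (g : FreeGroup α) :
    ∑ x, foxDeriv x g * (of ℤ _ (FreeGroup.of x) - 1) = of ℤ _ g - 1 := by
  induction g using FreeGroup.induction_on with
  | C1 => simp only [foxDeriv_one, zero_mul, Finset.sum_const_zero, map_one, sub_self]
  | of y => simp [foxDeriv_of, ite_mul]
  | inv_of y h =>
    simp only [foxDeriv_inv, neg_mul, Finset.sum_neg_distrib, mul_assoc, ← Finset.mul_sum, h]
    rw [mul_sub, ← map_mul, inv_mul_cancel, map_one]
    noncomm_ring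
  | mul g h hg hh =>
    simp only [foxDeriv_mul, add_mul, mul_assoc, Finset.sum_add_distrib, ← Finset.mul_sum, hg, hh,
      map_mul]
    noncomm_ring

end FoxCalculus

section ExponentSum

variable {α : Type*}

/-- The exponent sum of a word, i.e. its image under the homomorphism to `ℤ` sending every
generator to `1`. -/
def exponentSum (g : FreeGroup α) : ℤ :=
  Multiplicative.toAdd (FreeGroup.lift (fun _ => Multiplicative.ofAdd (1 : ℤ)) g)

theorem exponentSum_of (x : α) : exponentSum (FreeGroup.of x) = 1 := by simp [exponentSum]

theorem exponentSum_mul (g h : FreeGroup α) :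
    exponentSum (g * h) = exponentSum g + exponentSum h := by simp [exponentSum]

theorem exponentSum_inv (g : FreeGroup α) : exponentSum g⁻¹ = -exponentSum g := by
  simp [exponentSum]

theorem exponentSum_pow (g : FreeGroup α) (p : ℕ) : exponentSum (g ^ p) = p * exponentSum g := by
  simp [exponentSum]

theorem exponentSum_zpow (g : FreeGroup α) (i : ℤ) : exponentSum (g ^ i) = i * exponentSum g := by
  simp [exponentSum]

end ExponentSum

section Words

open MonoidAlgebra (of)

theorem w_even (m : ℕ) : w (2 * m) = (b * a⁻¹) ^ m * (b⁻¹ * a) ^ m := by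
  simp [w]

theorem w_odd (m : ℕ) : w (2 * m + 1) = (b * a⁻¹) ^ m * (b * a) * (b⁻¹ * a) ^ m := by
  simp [w, show (2 * m + 1) / 2 = m by lia]

theorem r_eq_conj_mul_inv (k : ℕ) (n : ℤ) : r k n = w k ^ n * a * (w k ^ n)⁻¹ * b⁻¹ := by
  rw [r, zpow_neg]

theorem exponentSum_a : exponentSum a = 1 := exponentSum_of 0

theorem exponentSum_b : exponentSum b = 1 := exponentSum_of 1

theorem exponentSum_w_even (m : ℕ) : exponentSum (w (2 * m)) = 0 := by
  simp [w_even, exponentSum_mul, exponentSum_pow, exponentSum_inv, exponentSum_a, exponentSum_b]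

theorem exponentSum_w_odd (m : ℕ) : exponentSum (w (2 * m + 1)) = 2 := by
  simp [w_odd, exponentSum_mul, exponentSum_pow, exponentSum_inv, exponentSum_a, exponentSum_b]

theorem foxDeriv_zero_a : foxDeriv 0 a = 1 := by simp [a, foxDeriv_of]

theorem foxDeriv_zero_b : foxDeriv 0 b = 0 := by simp [b, foxDeriv_of]

theorem foxDeriv_zero_mul_inv : foxDeriv 0 (b * a⁻¹) = -of ℤ _ (b * a⁻¹) := by
  simp [foxDeriv_mul, foxDeriv_inv, foxDeriv_zero_a, foxDeriv_zero_b]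

theorem foxDeriv_zero_inv_mul : foxDeriv 0 (b⁻¹ * a) = of ℤ _ b⁻¹ := by
  simp [foxDeriv_mul, foxDeriv_inv, foxDeriv_zero_a, foxDeriv_zero_b]

theorem foxDeriv_w_even (m : ℕ) : foxDeriv 0 (w (2 * m)) =
    -((∑ i ∈ Finset.range m, of ℤ _ (b * a⁻¹) ^ i) * of ℤ _ (b * a⁻¹)) +
      of ℤ _ (b * a⁻¹) ^ m * ((∑ i ∈ Finset.range m, of ℤ _ (b⁻¹ * a) ^ i) * of ℤ _ b⁻¹) := by
  rw [w_even, foxDeriv_mul, foxDeriv_pow, foxDeriv_pow, foxDeriv_zero_mul_inv,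
    foxDeriv_zero_inv_mul, mul_neg, map_pow]

theorem one_add_mul_geom_sum_mul_inv {G R : Type*} [Group G] [Ring R] (τ : G →* R) (g h : G)
    (m : ℕ) : 1 + τ g * ((∑ i ∈ Finset.range m, τ (h⁻¹ * g) ^ i) * τ h⁻¹) =
      ∑ i ∈ Finset.range (m + 1), τ (g * h⁻¹) ^ i := by
  have hterm (i : ℕ) : τ g * (τ (h⁻¹ * g) ^ i * τ h⁻¹) = τ (g * h⁻¹) ^ (i + 1) := by
    have hconj : (g * h⁻¹) ^ i = g * (h⁻¹ * g) ^ i * g⁻¹ := by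
      rw [← conj_pow]
      group
    simp only [← map_pow, ← map_mul]
    rw [pow_succ, hconj]
    group
  rw [Finset.sum_range_succ', pow_zero, add_comm, Finset.sum_mul, Finset.mul_sum]
  simp only [hterm]

theorem foxDeriv_w_odd (m : ℕ) : foxDeriv 0 (w (2 * m + 1)) =
    -((∑ i ∈ Finset.range m, of ℤ _ (b * a⁻¹) ^ i) * of ℤ _ (b * a⁻¹)) +
      of ℤ _ (b * a⁻¹) ^ m *
        (of ℤ _ b * ∑ i ∈ Finset.range (m + 1), of ℤ _ (a * b⁻¹) ^ i) := by
  have hba : foxDeriv 0 (b * a) = of ℤ _ b := by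
    rw [foxDeriv_mul, foxDeriv_zero_a, foxDeriv_zero_b, zero_add, mul_one]
  rw [w_odd, foxDeriv_mul, foxDeriv_mul, foxDeriv_pow, foxDeriv_pow, foxDeriv_zero_mul_inv,
    foxDeriv_zero_inv_mul, hba, ← one_add_mul_geom_sum_mul_inv, mul_neg, map_mul _ _ (b * a),
    map_mul _ b a, map_pow]
  noncomm_ring

theorem foxDeriv_r (k : ℕ) (n : ℤ) : foxDeriv 0 (r k n) =
    of ℤ _ (w k ^ n) +
      (1 - of ℤ _ (w k ^ n * a * (w k ^ n)⁻¹)) * foxDeriv 0 (w k ^ n) := by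
  rw [r_eq_conj_mul_inv, foxDeriv_mul, foxDeriv_inv, foxDeriv_conj, foxDeriv_zero_a,
    foxDeriv_zero_b, mul_zero, neg_zero, mul_zero, add_zero, mul_one]

end Words

section FoxMatrix

open LaurentPolynomial
open MonoidAlgebra (of)

variable {k d : ℕ} {n : ℤ}

theorem proj_r : proj k n (r k n) = 1 := PresentedGroup.one_of_mem rfl

theorem proj_conj_eq : proj k n (w k ^ n * a * (w k ^ n)⁻¹) = proj k n b := by
  rw [← mul_inv_eq_one, ← map_inv, ← map_mul, ← r_eq_conj_mul_inv, proj_r]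

theorem abel_proj (g : FreeGroup (Fin 2)) :
    Multiplicative.toAdd (abel k n (proj k n g)) = exponentSum g := rfl

variable (ρ : KnotGroup k n →* SL(d, ℂ))

theorem Phi_of (g : FreeGroup (Fin 2)) :
    Phi ρ (of ℤ _ g) = (T (exponentSum g) : ℂ[T;T⁻¹]) • (ρ (proj k n g)).1.map C := by
  rw [← abel_proj (k := k) (n := n)]
  simp [Phi, tensorRep]

theorem Phi_of_eq_of_proj_eq {g h : FreeGroup (Fin 2)} (hgh : proj k n g = proj k n h) :
    Phi ρ (of ℤ _ g) = Phi ρ (of ℤ _ h) := by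
  simp [Phi, hgh]

theorem Phi_foxDeriv_r_mul : Phi ρ (foxDeriv 0 (r k n)) * (1 - Phi ρ (of ℤ _ a)) =
    -Phi ρ (foxDeriv 1 (r k n)) * (1 - Phi ρ (of ℤ _ b)) := by
  have h := congrArg (Phi ρ) (sum_foxDeriv_mul_of_sub_one (r k n))
  rw [Fin.sum_univ_two, map_add, map_sub _ (of ℤ _ (r k n)), map_one,
    Phi_of_eq_of_proj_eq ρ (proj_r.trans (map_one _).symm), map_one, map_one, sub_self] at h
  simp only [map_mul, map_sub, map_one] at h
  change Phi ρ (foxDeriv 0 (r k n)) * (Phi ρ (of ℤ _ a) - 1) +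
    Phi ρ (foxDeriv 1 (r k n)) * (Phi ρ (of ℤ _ b) - 1) = 0 at h
  rw [← sub_eq_zero, ← neg_eq_zero, ← h]
  noncomm_ring

theorem Phi_foxDeriv_r (N : ℕ) (hn : n = -N) : Phi ρ (foxDeriv 0 (r k n)) =
    Phi ρ (of ℤ _ (w k)⁻¹) ^ N - (1 - Phi ρ (of ℤ _ b)) *
      ((∑ i ∈ Finset.range N, Phi ρ (of ℤ _ (w k)⁻¹) ^ i) * Phi ρ (of ℤ _ (w k)⁻¹) *
        Phi ρ (foxDeriv 0 (w k))) := by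
  have hw : w k ^ n = (w k)⁻¹ ^ N := by rw [hn, zpow_neg, zpow_natCast, inv_pow]
  rw [foxDeriv_r, map_add, map_mul, map_sub, map_one, Phi_of_eq_of_proj_eq ρ proj_conj_eq, hw,
    foxDeriv_pow, foxDeriv_inv, map_pow, map_mul, map_sum, map_neg, map_mul]
  simp only [map_pow]
  noncomm_ring

end FoxMatrix

section LeadingTermsOfFoxMatrix

open MonoidAlgebra (of)

variable {k d : ℕ} {n : ℤ} (ρ : KnotGroup k n →* SL(d, ℂ))

/-- The matrix of a word in `a, b` under a representation of the knot group. -/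
def wordMatrix (g : FreeGroup (Fin 2)) : Matrix (Fin d) (Fin d) ℂ := (ρ (proj k n g)).1

theorem hasLeadingTerm_Phi_of {ε e : ℤ} {g : FreeGroup (Fin 2)} (hg : exponentSum g = ε * e) :
    HasLeadingTerm ε e (Phi ρ (of ℤ _ g)) (wordMatrix ρ g) := by
  rw [Phi_of, hg]
  exact .T_smul_map_C ε e _

theorem hasLeadingTerm_Phi_mul_inv (ε : ℤ) :
    HasLeadingTerm ε 0 (Phi ρ (of ℤ _ (b * a⁻¹))) (wordMatrix ρ (b * a⁻¹)) :=
  hasLeadingTerm_Phi_of ρ (by simp [exponentSum_mul, exponentSum_inv, exponentSum_a, exponentSum_b])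

theorem hasLeadingTerm_Phi_inv_mul (ε : ℤ) :
    HasLeadingTerm ε 0 (Phi ρ (of ℤ _ (b⁻¹ * a))) (wordMatrix ρ (b⁻¹ * a)) :=
  hasLeadingTerm_Phi_of ρ (by simp [exponentSum_mul, exponentSum_inv, exponentSum_a, exponentSum_b])

theorem hasLeadingTerm_Phi_mul_inv' (ε : ℤ) :
    HasLeadingTerm ε 0 (Phi ρ (of ℤ _ (a * b⁻¹))) (wordMatrix ρ (a * b⁻¹)) :=
  hasLeadingTerm_Phi_of ρ (by simp [exponentSum_mul, exponentSum_inv, exponentSum_a, exponentSum_b])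

theorem hasLeadingTerm_low_one_sub_Phi_b : HasLeadingTerm 1 0 (1 - Phi ρ (of ℤ _ b)) 1 := by
  rw [sub_eq_add_neg]
  exact HasLeadingTerm.one.add_of_lt
    (hasLeadingTerm_Phi_of ρ (e := 1) (by rw [exponentSum_b, mul_one])).neg one_pos

theorem hasLeadingTerm_high_one_sub_Phi_b :
    HasLeadingTerm (-1) (-1) (1 - Phi ρ (of ℤ _ b)) (-wordMatrix ρ b) := by
  rw [sub_eq_neg_add]
  exact (hasLeadingTerm_Phi_of ρ (by rw [exponentSum_b]; rfl)).neg.add_of_lt .one (by norm_num)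

theorem hasLeadingTerm_low_Phi_foxDeriv_w_even (m : ℕ) :
    HasLeadingTerm 1 (-1) (Phi ρ (foxDeriv 0 (w (2 * m))))
      (wordMatrix ρ (b * a⁻¹) ^ m *
        ((∑ i ∈ Finset.range m, wordMatrix ρ (b⁻¹ * a) ^ i) * wordMatrix ρ b⁻¹)) := by
  have hx := hasLeadingTerm_Phi_mul_inv ρ 1
  have hz := hasLeadingTerm_Phi_inv_mul ρ 1
  have hb := hasLeadingTerm_Phi_of ρ (ε := 1) (e := -1) (g := b⁻¹)
    (by rw [exponentSum_inv, exponentSum_b, one_mul])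
  have h := ((hx.pow m).mul ((hz.geom_sum_of_zero m).mul hb)).add_of_lt
    ((hx.geom_sum_of_zero m).mul hx).neg (by norm_num)
  rw [foxDeriv_w_even, add_comm]
  simpa only [map_add, map_neg, map_mul (Phi ρ) (Finset.sum _ _), map_mul (Phi ρ) (_ ^ _), map_sum,
    map_pow, mul_zero, zero_add] using h

theorem hasLeadingTerm_high_Phi_foxDeriv_w_even (m : ℕ) :
    HasLeadingTerm (-1) 0 (Phi ρ (foxDeriv 0 (w (2 * m))))
      (-((∑ i ∈ Finset.range m, wordMatrix ρ (b * a⁻¹) ^ i) * wordMatrix ρ (b * a⁻¹))) := by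
  have hx := hasLeadingTerm_Phi_mul_inv ρ (-1)
  have hz := hasLeadingTerm_Phi_inv_mul ρ (-1)
  have hb := hasLeadingTerm_Phi_of ρ (ε := -1) (e := 1) (g := b⁻¹)
    (by rw [exponentSum_inv, exponentSum_b, mul_one])
  have h := ((hx.geom_sum_of_zero m).mul hx).neg.add_of_lt
    ((hx.pow m).mul ((hz.geom_sum_of_zero m).mul hb)) (by norm_num)
  rw [foxDeriv_w_even]
  simpa only [map_add, map_neg, map_mul (Phi ρ) (Finset.sum _ _), map_mul (Phi ρ) (_ ^ _), map_sum,
    map_pow, zero_add] using h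

theorem hasLeadingTerm_low_Phi_foxDeriv_w_odd (m : ℕ) :
    HasLeadingTerm 1 0 (Phi ρ (foxDeriv 0 (w (2 * m + 1))))
      (-((∑ i ∈ Finset.range m, wordMatrix ρ (b * a⁻¹) ^ i) * wordMatrix ρ (b * a⁻¹))) := by
  have hx := hasLeadingTerm_Phi_mul_inv ρ 1
  have hy := hasLeadingTerm_Phi_mul_inv' ρ 1
  have hb := hasLeadingTerm_Phi_of ρ (ε := 1) (e := 1) (g := b) (by rw [exponentSum_b, mul_one])
  have h := ((hx.geom_sum_of_zero m).mul hx).neg.add_of_lt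
    ((hx.pow m).mul (hb.mul (hy.geom_sum_of_zero (m + 1)))) (by norm_num)
  rw [foxDeriv_w_odd]
  simpa only [map_add, map_neg, map_mul (Phi ρ) (Finset.sum _ _), map_mul (Phi ρ) (_ ^ _),
    map_mul (Phi ρ) _ (Finset.sum _ _), map_sum, map_pow, zero_add] using h

theorem hasLeadingTerm_high_Phi_foxDeriv_w_odd (m : ℕ) :
    HasLeadingTerm (-1) (-1) (Phi ρ (foxDeriv 0 (w (2 * m + 1))))
      (wordMatrix ρ (b * a⁻¹) ^ m *
        (wordMatrix ρ b * ∑ i ∈ Finset.range (m + 1), wordMatrix ρ (a * b⁻¹) ^ i)) := by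
  have hx := hasLeadingTerm_Phi_mul_inv ρ (-1)
  have hy := hasLeadingTerm_Phi_mul_inv' ρ (-1)
  have hb := hasLeadingTerm_Phi_of ρ (ε := -1) (e := -1) (g := b) (by rw [exponentSum_b]; rfl)
  have h := ((hx.pow m).mul (hb.mul (hy.geom_sum_of_zero (m + 1)))).add_of_lt
    ((hx.geom_sum_of_zero m).mul hx).neg (by norm_num)
  rw [foxDeriv_w_odd, add_comm]
  simpa only [map_add, map_neg, map_mul (Phi ρ) (Finset.sum _ _), map_mul (Phi ρ) (_ ^ _),
    map_mul (Phi ρ) _ (Finset.sum _ _), map_sum, map_pow, mul_zero, zero_add, add_zero] using h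

variable {m N : ℕ}

theorem hasLeadingTerm_low_Phi_foxDeriv_r_even (ρ : KnotGroup (2 * m) n →* SL(d, ℂ))
    (hn : n = -N) : HasLeadingTerm 1 (-1) (Phi ρ (foxDeriv 0 (r (2 * m) n)))
      (-((∑ i ∈ Finset.range N, wordMatrix ρ (w (2 * m))⁻¹ ^ i) * wordMatrix ρ (w (2 * m))⁻¹ *
        (wordMatrix ρ (b * a⁻¹) ^ m *
          ((∑ i ∈ Finset.range m, wordMatrix ρ (b⁻¹ * a) ^ i) * wordMatrix ρ b⁻¹)))) := by
  have hw := hasLeadingTerm_Phi_of ρ (ε := 1) (e := 0) (g := (w (2 * m))⁻¹)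
    (by rw [exponentSum_inv, exponentSum_w_even, neg_zero, mul_zero])
  have h := ((hasLeadingTerm_low_one_sub_Phi_b ρ).mul (((hw.geom_sum_of_zero N).mul hw).mul
    (hasLeadingTerm_low_Phi_foxDeriv_w_even ρ m))).neg.add_of_lt (hw.pow N) (by norm_num)
  rw [Phi_foxDeriv_r ρ N hn, sub_eq_neg_add]
  simpa only [zero_add, one_mul] using h

theorem hasLeadingTerm_high_Phi_foxDeriv_r_even (ρ : KnotGroup (2 * m) n →* SL(d, ℂ))
    (hn : n = -N) : HasLeadingTerm (-1) (-1) (Phi ρ (foxDeriv 0 (r (2 * m) n)))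
      (-(wordMatrix ρ b *
        ((∑ i ∈ Finset.range N, wordMatrix ρ (w (2 * m))⁻¹ ^ i) * wordMatrix ρ (w (2 * m))⁻¹ *
          ((∑ i ∈ Finset.range m, wordMatrix ρ (b * a⁻¹) ^ i) * wordMatrix ρ (b * a⁻¹))))) := by
  have hw := hasLeadingTerm_Phi_of ρ (ε := -1) (e := 0) (g := (w (2 * m))⁻¹)
    (by rw [exponentSum_inv, exponentSum_w_even, neg_zero, mul_zero])
  have h := ((hasLeadingTerm_high_one_sub_Phi_b ρ).mul (((hw.geom_sum_of_zero N).mul hw).mul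
    (hasLeadingTerm_high_Phi_foxDeriv_w_even ρ m))).neg.add_of_lt (hw.pow N) (by norm_num)
  rw [Phi_foxDeriv_r ρ N hn, sub_eq_neg_add]
  simpa only [add_zero, neg_mul, mul_neg, neg_neg] using h

theorem hasLeadingTerm_low_Phi_foxDeriv_r_odd (ρ : KnotGroup (2 * m + 1) n →* SL(d, ℂ))
    (hn : n = -(N + 1 : ℕ)) : HasLeadingTerm 1 (2 * n) (Phi ρ (foxDeriv 0 (r (2 * m + 1) n)))
      (wordMatrix ρ (w (2 * m + 1))⁻¹ ^ (N + 1) *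
        ∑ i ∈ Finset.range (m + 1), wordMatrix ρ (b * a⁻¹) ^ i) := by
  have hw := hasLeadingTerm_Phi_of ρ (ε := 1) (e := -2) (g := (w (2 * m + 1))⁻¹)
    (by rw [exponentSum_inv, exponentSum_w_odd, one_mul])
  have hlast := ((hasLeadingTerm_low_one_sub_Phi_b ρ).mul
    (((hw.geom_sum_of_neg (by norm_num) N).mul hw).mul
      (hasLeadingTerm_low_Phi_foxDeriv_w_odd ρ m))).neg
  have hdeg : ((N + 1 : ℕ) : ℤ) * -2 = 2 * n := by rw [hn]; ring
  have hdeg' : 0 + ((N : ℤ) * -2 + -2 + 0) = 2 * n := by rw [← hdeg]; push_cast; ring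
  rw [Phi_foxDeriv_r ρ (N + 1) hn, sub_eq_add_neg]
  convert (hdeg ▸ hw.pow (N + 1)).add (hdeg' ▸ hlast) using 1
  rw [Finset.sum_range_succ', Finset.sum_mul]
  simp only [pow_succ, pow_zero, one_mul, mul_add, mul_one, mul_neg, neg_neg, add_comm]

theorem hasLeadingTerm_high_Phi_foxDeriv_r_odd (ρ : KnotGroup (2 * m + 1) n →* SL(d, ℂ))
    (hn : n = -(N + 1 : ℕ)) : HasLeadingTerm (-1) 0 (Phi ρ (foxDeriv 0 (r (2 * m + 1) n)))
      (wordMatrix ρ b * (wordMatrix ρ (w (2 * m + 1))⁻¹ * (wordMatrix ρ (b * a⁻¹) ^ m *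
        (wordMatrix ρ b * ∑ i ∈ Finset.range (m + 1), wordMatrix ρ (a * b⁻¹) ^ i)))) := by
  have hw := hasLeadingTerm_Phi_of ρ (ε := -1) (e := 2) (g := (w (2 * m + 1))⁻¹)
    (by rw [exponentSum_inv, exponentSum_w_odd]; rfl)
  have h := ((hasLeadingTerm_high_one_sub_Phi_b ρ).mul
    (((hw.geom_sum_of_pos (by norm_num) N).mul hw).mul
      (hasLeadingTerm_high_Phi_foxDeriv_w_odd ρ m))).neg.add_of_lt (hw.pow (N + 1))
    (by push_cast; lia)
  rw [Phi_foxDeriv_r ρ (N + 1) hn, sub_eq_neg_add]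
  simpa only [neg_mul, neg_neg, one_mul, zero_mul, zero_add, Int.reduceAdd] using h

end LeadingTermsOfFoxMatrix

section Representations

variable {k : ℕ} {n : ℤ}

theorem commute_of_commute_meridians {H : Type*} [Group H] {f : KnotGroup k n →* H}
    (hab : Commute (f (proj k n a)) (f (proj k n b))) (g h : KnotGroup k n) :
    Commute (f g) (f h) := by
  have hcentral {x : H} (hxa : Commute x (f (proj k n a))) (hxb : Commute x (f (proj k n b)))
      (g : KnotGroup k n) : Commute x (f g) := by
    have hg := PresentedGroup.generated_by ({r k n} : Set (FreeGroup (Fin 2)))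
      ((Subgroup.centralizer {x}).comap f) (fun j => by
        rw [Subgroup.mem_comap, Subgroup.mem_centralizer_singleton_iff]
        fin_cases j
        · exact hxa.symm
        · exact hxb.symm) g
    rw [Subgroup.mem_comap, Subgroup.mem_centralizer_singleton_iff] at hg
    exact Commute.symm hg
  exact (hcentral (hcentral (.refl _) hab h).symm (hcentral hab.symm (.refl _) h).symm g).symm

variable (ρ : KnotGroup k n →* SL(2, ℂ))

theorem trace_proj_a_eq_trace_proj_b : (ρ (proj k n a)).1.trace = (ρ (proj k n b)).1.trace := by
  rw [← proj_conj_eq]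
  simp only [map_mul, map_inv]
  rw [trace_conj]

theorem trace_proj_inv (g : FreeGroup (Fin 2)) :
    (ρ (proj k n g⁻¹)).1.trace = (ρ (proj k n g)).1.trace := by
  rw [map_inv, map_inv, trace_inv]

theorem trace_proj_mul_inv : (ρ (proj k n (b * a⁻¹))).1.trace = yTrace ρ := by
  rw [yTrace, ← trace_proj_inv, mul_inv_rev, inv_inv]

theorem trace_proj_inv_mul : (ρ (proj k n (b⁻¹ * a))).1.trace = yTrace ρ := by
  rw [show b⁻¹ * a = b⁻¹ * (a * b⁻¹) * b⁻¹⁻¹ by group, map_mul, map_mul, map_inv _ b⁻¹, map_mul,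
    map_mul, map_inv _ (proj k n b⁻¹), trace_conj, yTrace]

namespace IsNonabelianParabolic

variable {ρ}

theorem not_commute (hρ : IsNonabelianParabolic ρ) :
    ¬Commute (ρ (proj k n a)) (ρ (proj k n b)) := by
  obtain ⟨g, h, hgh⟩ := hρ.nonabelian
  exact fun hab => hgh (commute_of_commute_meridians hab g h)

theorem ne (hρ : IsNonabelianParabolic ρ) : ρ (proj k n a) ≠ ρ (proj k n b) :=
  fun hab => hρ.not_commute (hab ▸ .refl _)

theorem sq_trace (hρ : IsNonabelianParabolic ρ) : (ρ (proj k n b)).1.trace ^ 2 = 4 := by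
  rw [← trace_proj_a_eq_trace_proj_b]
  rcases hρ.trace_meridian with h | h <;> rw [h] <;> norm_num

end IsNonabelianParabolic

end Representations

section ExtremeTerms

open LaurentPolynomial
open MonoidAlgebra (of)

variable {k : ℕ} {n : ℤ}

theorem one_sub_Phi_of_of_exponentSum_eq_one (ρ : KnotGroup k n →* SL(2, ℂ))
    {g : FreeGroup (Fin 2)} (hg : exponentSum g = 1) :
    1 - Phi (AdSL.comp ρ) (of ℤ _ g) = oneSubTAd (ρ (proj k n g)) := by
  rw [Phi_of, hg]
  rfl

theorem IsNonabelianParabolic.hasExtremeTerms {ρ : KnotGroup k n →* SL(2, ℂ)}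
    (hρ : IsNonabelianParabolic ρ) {e f : ℤ} {E F : Matrix (Fin 3) (Fin 3) ℂ}
    (hE : HasLeadingTerm 1 e (Phi (AdSL.comp ρ) (foxDeriv 0 (r k n))) E)
    (hF : HasLeadingTerm (-1) f (Phi (AdSL.comp ρ) (foxDeriv 0 (r k n))) F)
    {c c' : ℂ} (hc : c ≠ 0) (hc' : c' ≠ 0) (hEc : E.det = c') (hFc : F.det = -c) :
    HasExtremeTerms (adjointTwistedAlexander ρ) c (-(3 * f) - 3) c' (3 * e) := by
  have hrel := Phi_foxDeriv_r_mul (AdSL.comp ρ)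
  rw [one_sub_Phi_of_of_exponentSum_eq_one ρ exponentSum_a,
    one_sub_Phi_of_of_exponentSum_eq_one ρ exponentSum_b] at hrel
  obtain ⟨P, hP⟩ := one_sub_T_pow_three_dvd_det hρ.not_commute hρ.sq_trace hrel
  rw [mul_comm] at hP
  have hlow : (P * (1 - T 1) ^ 3).coeff (3 * e) = c' := by
    simpa only [hP, one_mul, Fintype.card_fin, Nat.cast_ofNat, hEc] using hE.coeff_det one_ne_zero
  have hhigh : (P * (1 - T 1) ^ 3).coeff (-(3 * f) - 3 + (3 : ℕ)) = -c := by
    simpa only [hP, neg_one_mul, hFc, Fintype.card_fin, Nat.cast_ofNat, sub_add_cancel]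
      using hF.coeff_det (neg_ne_zero.2 one_ne_zero)
  obtain ⟨hsupp, hlo, hhi⟩ := coeff_of_mul_one_sub_T_pow 3 (f := P) (lo := 3 * e)
    (hi := -(3 * f) - 3) fun i hi => by
      rw [← hP] at hi
      have hle := mt (hE.coeff_det_of_lt isUnit_one) hi
      have hge := mt (hF.coeff_det_of_lt isUnit_one.neg) hi
      rw [Fintype.card_fin] at hle hge
      lia
  have hden : (Phi (AdSL.comp ρ) (1 - of ℤ _ b)).det = (1 - T 1) ^ 3 := by
    rw [map_sub, map_one, one_sub_Phi_of_of_exponentSum_eq_one ρ exponentSum_b,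
      det_oneSubTAd_of_parabolic hρ.sq_trace]
  have hden₀ : (1 - T 1 : ℂ[T;T⁻¹]) ^ 3 ≠ 0 := fun h₀ => hc' (by rw [← hlow, h₀]; simp)
  refine ⟨P, ?_, hc, hc', by rw [hhi, hhigh]; ring, hlo.trans hlow, hsupp⟩
  rw [adjointTwistedAlexander, twistedAlexander, hden, hP, map_mul, mul_div_cancel_right₀]
  rwa [Ne, FaithfulSMul.algebraMap_eq_zero_iff]

theorem det_wordMatrix {d : ℕ} (ρ : KnotGroup k n →* SL(d, ℂ)) (g : FreeGroup (Fin 2)) :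
    (wordMatrix ρ g).det = 1 :=
  (ρ (proj k n g)).2

theorem det_geom_sum_wordMatrix (ρ : KnotGroup k n →* SL(2, ℂ)) (g : FreeGroup (Fin 2)) (p : ℕ) :
    (∑ i ∈ Finset.range p, wordMatrix (AdSL.comp ρ) g ^ i).det =
      p * S ((p : ℤ) - 1) (ρ (proj k n g)).1.trace ^ 2 :=
  det_geom_sum_AdSL _ p

variable {m N : ℕ}

theorem IsNonabelianParabolic.hasExtremeTerms_even {ρ : KnotGroup (2 * m) n →* SL(2, ℂ)}
    (hρ : IsNonabelianParabolic ρ) (hn : n = -N) {c : ℂ} (hc₀ : c ≠ 0)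
    (hc : c = m * N * S ((m : ℤ) - 1) (yTrace ρ) ^ 2 * S ((N : ℤ) - 1) (zTrace ρ) ^ 2) :
    HasExtremeTerms (adjointTwistedAlexander ρ) c 0 (-c) (-3) := by
  refine hρ.hasExtremeTerms (hasLeadingTerm_low_Phi_foxDeriv_r_even (AdSL.comp ρ) hn)
    (hasLeadingTerm_high_Phi_foxDeriv_r_even (AdSL.comp ρ) hn) hc₀ (neg_ne_zero.2 hc₀) ?_ ?_ <;>
  · simp only [Matrix.det_neg, Matrix.det_mul, Matrix.det_pow, det_wordMatrix,
      det_geom_sum_wordMatrix, trace_proj_inv, trace_proj_mul_inv, trace_proj_inv_mul, zTrace,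
      Fintype.card_fin, hc]
    ring

theorem IsNonabelianParabolic.hasExtremeTerms_odd {ρ : KnotGroup (2 * m + 1) n →* SL(2, ℂ)}
    (hρ : IsNonabelianParabolic ρ) (hn : n = -(N + 1 : ℕ)) {c : ℂ} (hc₀ : c ≠ 0)
    (hc : c = (m + 1) * S m (yTrace ρ) ^ 2) :
    HasExtremeTerms (adjointTwistedAlexander ρ) (-c) (-3) c (6 * n) := by
  rw [show 6 * n = 3 * (2 * n) by ring]
  refine hρ.hasExtremeTerms (hasLeadingTerm_low_Phi_foxDeriv_r_odd (AdSL.comp ρ) hn)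
    (hasLeadingTerm_high_Phi_foxDeriv_r_odd (AdSL.comp ρ) hn) (neg_ne_zero.2 hc₀) hc₀ ?_ ?_ <;>
  · simp only [Matrix.det_mul, Matrix.det_pow, det_wordMatrix, det_geom_sum_wordMatrix,
      trace_proj_mul_inv, yTrace, hc, Nat.cast_add_one, add_sub_cancel_right]
    ring

end ExtremeTerms

section Chebyshev

variable {R : Type*} [CommRing R]

theorem coe_mul_self (g : SL(2, R)) : g.1 * g.1 = g.1.trace • g.1 - 1 := by
  have hdet := entries_mul_sub_eq_one g
  ext i j
  fin_cases i <;> fin_cases j <;>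
    simp [Matrix.mul_apply, Fin.sum_univ_two, Matrix.trace_fin_two] <;> grind

theorem coe_pow_eq_chebyshev (g : SL(2, R)) (p : ℕ) :
    (g ^ p).1 = (Polynomial.Chebyshev.S R ((p : ℤ) - 1)).eval g.1.trace • g.1 -
      (Polynomial.Chebyshev.S R ((p : ℤ) - 2)).eval g.1.trace • (1 : Matrix (Fin 2) (Fin 2) R) := by
  induction p with
  | zero => simp
  | succ p ih =>
    rw [pow_succ, Matrix.SpecialLinearGroup.coe_mul, ih,
      show ((p + 1 : ℕ) : ℤ) - 1 = p by lia, show ((p + 1 : ℕ) : ℤ) - 2 = p - 1 by lia,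
      Polynomial.Chebyshev.S_eq R p, sub_mul, smul_mul_assoc, coe_mul_self, smul_mul_assoc,
      one_mul, Polynomial.eval_sub, Polynomial.eval_mul, Polynomial.eval_X]
    module

theorem S_sq_add_S_sq (l : ℤ) (v : ℂ) :
    S l v ^ 2 + S (l + 1) v ^ 2 - v * S l v * S (l + 1) v = 1 := by
  simpa [S] using congrArg (Polynomial.eval v) (Polynomial.Chebyshev.S_sq_add_S_sq ℂ l)

theorem exists_central_involution_of_S_eq_zero {p : ℕ} {v : ℂ} (h : S ((p : ℤ) - 1) v = 0) :
    ∃ c : SL(2, ℂ), c * c = 1 ∧ (∀ x, Commute c x) ∧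
      ∀ g : SL(2, ℂ), g.1.trace = v → g ^ p = c := by
  have hsq := S_sq_add_S_sq ((p : ℤ) - 2) v
  rw [show (p : ℤ) - 2 + 1 = p - 1 by ring, h] at hsq
  have hs : -S ((p : ℤ) - 2) v * -S ((p : ℤ) - 2) v = 1 := by linear_combination hsq
  let c : SL(2, ℂ) := ⟨-S ((p : ℤ) - 2) v • 1, by
    rw [Matrix.det_smul, Matrix.det_one, Fintype.card_fin, sq, hs, mul_one]⟩
  refine ⟨c, Subtype.ext ?_, fun x => Subtype.ext ?_, ?_⟩
  · rw [Matrix.SpecialLinearGroup.coe_mul, smul_mul_smul_comm, hs, one_smul, one_mul]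
    rfl
  · change -S ((p : ℤ) - 2) v • 1 * x.1 = x.1 * -S ((p : ℤ) - 2) v • 1
    rw [smul_mul_assoc, mul_smul_comm, one_mul, mul_one]
  · rintro g rfl
    refine Subtype.ext ((coe_pow_eq_chebyshev g p).trans ?_)
    rw [show (Polynomial.Chebyshev.S ℂ _).eval _ = (0 : ℂ) from h, zero_smul, zero_sub, ← neg_smul]
    rfl

theorem exists_real_le_two_of_S_eq_zero {p : ℕ} {v : ℂ} (h : S p v = 0) :
    ∃ x : ℝ, v = x ∧ x ≤ 2 := by
  obtain ⟨s, hs, rfl⟩ := exists_ne_zero_add_inv_eq v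
  have hgeom : s * ∑ i ∈ Finset.range (p + 1), (s ^ 2) ^ i = 0 := by
    rw [← pow_mul_S_add_inv hs, Nat.cast_succ, add_sub_cancel_right, h, mul_zero]
  have hroot : s ^ (2 * (p + 1)) = 1 := by
    rw [pow_mul, ← sub_eq_zero, ← mul_geom_sum, (mul_eq_zero.1 hgeom).resolve_left hs, mul_zero]
  have hnorm : ‖s‖ = 1 := Complex.norm_eq_one_of_pow_eq_one hroot (by lia)
  refine ⟨2 * s.re, ?_, ?_⟩
  · rw [Complex.inv_eq_conj hnorm, Complex.add_conj]
  · linarith [Complex.re_le_norm s]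

theorem eval_S_nonneg_and_add_one_le {x : ℝ} (hx : 2 ≤ x) (p : ℕ) :
    0 ≤ (Polynomial.Chebyshev.S ℝ ((p : ℤ) - 1)).eval x ∧
      (Polynomial.Chebyshev.S ℝ ((p : ℤ) - 1)).eval x + 1 ≤
        (Polynomial.Chebyshev.S ℝ p).eval x := by
  induction p with
  | zero => simp
  | succ p ih =>
    obtain ⟨h₀, h₁⟩ := ih
    rw [Nat.cast_succ, add_sub_cancel_right, Polynomial.Chebyshev.S_add_one, Polynomial.eval_sub,
      Polynomial.eval_mul, Polynomial.eval_X]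
    exact ⟨by linarith, by nlinarith⟩

end Chebyshev

section TorusRelation

theorem trace_mul_add_trace_mul_inv {R : Type*} [CommRing R] (α β : SL(2, R)) :
    (α * β).1.trace + (α * β⁻¹).1.trace = α.1.trace * β.1.trace := by
  rw [Matrix.SpecialLinearGroup.coe_mul, Matrix.SpecialLinearGroup.coe_mul,
    Matrix.SpecialLinearGroup.coe_inv, Matrix.adjugate_fin_two]
  simp [Matrix.trace_fin_two, Matrix.mul_apply, Fin.sum_univ_two]
  ring

theorem eq_mul_of_pow_succ_eq_involution {G : Type*} [Group G] {α β c : G} {p : ℕ} (hc : c * c = 1)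
    (hcomm : ∀ x, Commute c x) (hx : (β * α⁻¹) ^ (p + 1) = c) (hz : (β⁻¹ * α) ^ (p + 1) = c) :
    (β * α⁻¹) ^ p * (β * α) * (β⁻¹ * α) ^ p = α * β := by
  have hx' : (β * α⁻¹) ^ p = c * (β * α⁻¹)⁻¹ := by rw [← hx, pow_succ, mul_inv_cancel_right]
  have hz' : (β⁻¹ * α) ^ p = (β⁻¹ * α)⁻¹ * c := by rw [← hz, pow_succ', inv_mul_cancel_left]
  calc (β * α⁻¹) ^ p * (β * α) * (β⁻¹ * α) ^ p = c * (α * β * c) := by rw [hx', hz']; group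
    _ = α * β := by rw [← (hcomm (α * β)).eq, ← mul_assoc, hc, one_mul]

theorem S_eq_S_of_torus_relation {α β : SL(2, ℂ)} (htr : α.1.trace = β.1.trace) (hne : α ≠ β)
    {p : ℕ} (h : α * (α * β) ^ p = (α * β) ^ p * β) :
    S ((p : ℤ) - 1) (α * β).1.trace = S ((p : ℤ) - 2) (α * β).1.trace := by
  have hA := coe_mul_self α
  have hB := coe_mul_self β
  have h' := congrArg Subtype.val h
  rw [Matrix.SpecialLinearGroup.coe_mul α, Matrix.SpecialLinearGroup.coe_mul _ β,
    coe_pow_eq_chebyshev] at h'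
  change α.1 * (S _ _ • (α * β).1 - S _ _ • 1) = (S _ _ • (α * β).1 - S _ _ • 1) * β.1 at h'
  rw [Matrix.SpecialLinearGroup.coe_mul] at h' ⊢
  rw [htr] at hA
  generalize S ((p : ℤ) - 1) _ = x at *
  generalize S ((p : ℤ) - 2) _ = y at *
  generalize β.1.trace = τ at *
  have hdiff : (x - y) • (α.1 - β.1) = 0 := by
    calc (x - y) • (α.1 - β.1)
      _ = x • ((τ • α.1 - 1) * β.1) - y • α.1 - (x • (α.1 * (τ • β.1 - 1)) - y • β.1) := by
        rw [sub_mul, mul_sub, smul_mul_assoc, mul_smul_comm, one_mul, mul_one]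
        module
      _ = α.1 * (x • (α.1 * β.1) - y • 1) - (x • (α.1 * β.1) - y • 1) * β.1 := by
        rw [← hA, ← hB]
        simp only [mul_sub, sub_mul, mul_smul_comm, smul_mul_assoc, mul_one, one_mul, mul_assoc]
      _ = 0 := sub_eq_zero.2 h'
  refine sub_eq_zero.1 ((smul_eq_zero.1 hdiff).resolve_right fun hαβ => ?_)
  exact hne (Subtype.ext (sub_eq_zero.1 hαβ))

end TorusRelation

section Nonvanishing

variable {k m N : ℕ} {n : ℤ}

theorem S_yTrace_ne_zero_even {ρ : KnotGroup (2 * m) n →* SL(2, ℂ)}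
    (hne : ρ (proj (2 * m) n a) ≠ ρ (proj (2 * m) n b)) : S ((m : ℤ) - 1) (yTrace ρ) ≠ 0 := by
  intro h
  obtain ⟨c, hc, -, hpow⟩ := exists_central_involution_of_S_eq_zero h
  have hw : ρ (proj (2 * m) n (w (2 * m))) = 1 := by
    simp only [w_even, map_mul ρ, map_mul (proj _ _) (_ ^ _), map_pow,
      hpow _ (trace_proj_mul_inv ρ), hpow _ (trace_proj_inv_mul ρ), hc]
  apply hne
  rw [← proj_conj_eq]
  simp only [map_mul, map_inv, map_zpow, hw, one_zpow, one_mul, inv_one, mul_one]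

theorem S_zTrace_ne_zero {ρ : KnotGroup k n →* SL(2, ℂ)} (hn : n = -N)
    (hne : ρ (proj k n a) ≠ ρ (proj k n b)) : S ((N : ℤ) - 1) (zTrace ρ) ≠ 0 := by
  intro h
  obtain ⟨c, hc, hcomm, hpow⟩ := exists_central_involution_of_S_eq_zero h
  have hwn : ρ (proj k n (w k)) ^ n = c := by
    rw [congrArg (ρ (proj k n (w k)) ^ ·) hn, zpow_neg, zpow_natCast, hpow _ rfl,
      inv_eq_of_mul_eq_one_left hc]
  apply hne
  rw [← proj_conj_eq]
  simp only [map_mul, map_inv, map_zpow, hwn, (hcomm _).eq, mul_inv_cancel_right]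

theorem IsNonabelianParabolic.S_yTrace_ne_zero_odd {ρ : KnotGroup (2 * m + 1) n →* SL(2, ℂ)}
    (hρ : IsNonabelianParabolic ρ) (hn : n = -(N + 1 : ℕ)) : S m (yTrace ρ) ≠ 0 := by
  intro h
  obtain ⟨c, hc, hcomm, hpow⟩ := exists_central_involution_of_S_eq_zero (p := m + 1) (v := yTrace ρ)
    (by rwa [Nat.cast_succ, add_sub_cancel_right])
  set α := ρ (proj _ n a)
  set β := ρ (proj _ n b)
  have htrace : α.1.trace = β.1.trace := trace_proj_a_eq_trace_proj_b ρ
  have hw : ρ (proj _ n (w (2 * m + 1))) = α * β := by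
    rw [w_odd]
    have hx := hpow _ (trace_proj_mul_inv ρ)
    have hz := hpow _ (trace_proj_inv_mul ρ)
    simp only [map_mul, map_inv, map_pow] at hx hz ⊢
    exact eq_mul_of_pow_succ_eq_involution hc hcomm hx hz
  have htorus : α * (α * β) ^ (N + 1) = (α * β) ^ (N + 1) * β := by
    have hconj := congrArg ρ (proj_conj_eq (k := 2 * m + 1) (n := n))
    simp only [map_mul, map_inv, map_zpow, hw] at hconj
    have hn' : (α * β) ^ n = ((α * β) ^ (N + 1))⁻¹ := by rw [hn, zpow_neg, zpow_natCast]
    rwa [hn', inv_inv, mul_assoc, inv_mul_eq_iff_eq_mul] at hconj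
  have hS := S_eq_S_of_torus_relation htrace (fun hab => hρ.ne hab) htorus
  obtain ⟨x, hx, hx₂⟩ := exists_real_le_two_of_S_eq_zero h
  have ht : (α * β).1.trace = ((4 - x : ℝ) : ℂ) := by
    have htr := trace_mul_add_trace_mul_inv α β
    have hy : (α * β⁻¹).1.trace = yTrace ρ := by rw [yTrace, map_mul, map_mul, map_inv, map_inv]
    have hsq : β.1.trace ^ 2 = 4 := hρ.sq_trace
    rw [hy, hx, htrace] at htr
    push_cast
    linear_combination htr + hsq
  rw [ht, show ((N + 1 : ℕ) : ℤ) - 1 = N by lia, show ((N + 1 : ℕ) : ℤ) - 2 = N - 1 by lia,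
    S, S, ← Polynomial.Chebyshev.complex_ofReal_eval_S,
    ← Polynomial.Chebyshev.complex_ofReal_eval_S,
    Complex.ofReal_inj] at hS
  linarith [eval_S_nonneg_and_add_one_le (x := 4 - x) (by linarith) N]

end Nonvanishing

section Longitude

theorem semiconjBy_mul_inv_pow {G : Type*} [Group G] (α β : G) (m : ℕ) :
    (β * α⁻¹) ^ m * α = α * ((β⁻¹ * α) ^ m)⁻¹ ∧ (β * α⁻¹) ^ m * β = β * ((β⁻¹ * α) ^ m)⁻¹ := by
  have hα : SemiconjBy α (β⁻¹ * α)⁻¹ (β * α⁻¹) := by rw [SemiconjBy]; group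
  have hβ : SemiconjBy β (β⁻¹ * α)⁻¹ (β * α⁻¹) := by rw [SemiconjBy]; group
  rw [← inv_pow]
  exact ⟨(hα.pow_right m).eq.symm, (hβ.pow_right m).eq.symm⟩

theorem semiconjBy_swap_even {G : Type*} [Group G] {α β : G} {m : ℕ} {n : ℤ}
    (h : SemiconjBy (((β * α⁻¹) ^ m * (β⁻¹ * α) ^ m) ^ n) α β) :
    SemiconjBy (((α * β⁻¹) ^ m * (α⁻¹ * β) ^ m) ^ n) β α := by
  obtain ⟨hα, hβ⟩ := semiconjBy_mul_inv_pow α β m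
  rw [show α * β⁻¹ = (β * α⁻¹)⁻¹ by group, show α⁻¹ * β = (β⁻¹ * α)⁻¹ by group, inv_pow, inv_pow]
  generalize (β * α⁻¹) ^ m = X at *
  generalize (β⁻¹ * α) ^ m = Z at *
  rw [← SemiconjBy.conj_iff (b := X), ← conj_zpow, hα, hβ,
    show X * (X⁻¹ * Z⁻¹) * X⁻¹ = (X * Z)⁻¹ by group, inv_zpow, mul_assoc, mul_assoc, ← mul_inv_rev]
  exact h.inv_symm_left.mul_right ((Commute.refl (X * Z)).zpow_left n).inv_inv

theorem semiconjBy_swap_odd {G : Type*} [Group G] {α β : G} {m : ℕ} {n : ℤ}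
    (h : SemiconjBy (((β * α⁻¹) ^ m * (β * α) * (β⁻¹ * α) ^ m) ^ n) α β) :
    SemiconjBy (((α * β⁻¹) ^ m * (α * β) * (α⁻¹ * β) ^ m) ^ n) β α := by
  obtain ⟨hα, hβ⟩ := semiconjBy_mul_inv_pow α β m
  rw [show α * β⁻¹ = (β * α⁻¹)⁻¹ by group, show α⁻¹ * β = (β⁻¹ * α)⁻¹ by group, inv_pow, inv_pow]
  generalize (β * α⁻¹) ^ m = X at *
  generalize (β⁻¹ * α) ^ m = Z at *
  have hαZ : α * Z = X⁻¹ * α := by rw [eq_inv_mul_iff_mul_eq, ← mul_assoc, hα, inv_mul_cancel_right]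
  have hW : X * (β * α) * Z = β * Z⁻¹ * X⁻¹ * α := by
    rw [← mul_assoc X, hβ, mul_assoc _ α, hαZ, mul_assoc _ X⁻¹]
  rw [hW] at h
  generalize hV : β * Z⁻¹ * X⁻¹ * α = V at *
  rw [← SemiconjBy.conj_iff (b := α⁻¹ * X), ← conj_zpow,
    show α⁻¹ * X * (X⁻¹ * (α * β) * Z⁻¹) * (α⁻¹ * X)⁻¹ = V by rw [← hV]; group,
    show α⁻¹ * X * α * (α⁻¹ * X)⁻¹ = β⁻¹ * V by rw [mul_assoc α⁻¹, hα, ← hV]; group,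
    show α⁻¹ * X * β * (α⁻¹ * X)⁻¹ = α⁻¹ * V by rw [mul_assoc α⁻¹, hβ, ← hV]; group]
  exact h.inv_right.mul_right ((Commute.refl V).zpow_left n)

/-- The endomorphism of the free group exchanging the generators `a` and `b`. -/
def swap : FreeGroup (Fin 2) →* FreeGroup (Fin 2) := FreeGroup.lift ![b, a]

theorem swap_a : swap a = b := FreeGroup.lift_apply_of

theorem swap_b : swap b = a := FreeGroup.lift_apply_of

theorem exponentSum_swap (g : FreeGroup (Fin 2)) : exponentSum (swap g) = exponentSum g := by
  induction g using FreeGroup.induction_on with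
  | C1 => rw [map_one]
  | of y =>
    fin_cases y
    · exact (congrArg exponentSum swap_a).trans (exponentSum_b.trans exponentSum_a.symm)
    · exact (congrArg exponentSum swap_b).trans (exponentSum_a.trans exponentSum_b.symm)
  | inv_of y ih => rw [map_inv, exponentSum_inv, exponentSum_inv, ih]
  | mul g h hg hh => rw [map_mul, exponentSum_mul, exponentSum_mul, hg, hh]

/-- The word of the longitude commuting with the meridian `a`, up to a power of `a`. -/
def longitude (k : ℕ) (n : ℤ) : FreeGroup (Fin 2) := swap (w k ^ n) * w k ^ n

variable (k : ℕ) (n : ℤ)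

theorem semiconjBy_proj_w_zpow : SemiconjBy (proj k n (w k ^ n)) (proj k n a) (proj k n b) := by
  rw [SemiconjBy, ← proj_conj_eq, ← map_mul, ← map_mul, inv_mul_cancel_right]

theorem semiconjBy_proj_swap_w_zpow :
    SemiconjBy (proj k n (swap (w k ^ n))) (proj k n b) (proj k n a) := by
  have h := semiconjBy_proj_w_zpow k n
  rw [map_zpow] at h
  rw [map_zpow, map_zpow]
  rcases Nat.even_or_odd' k with ⟨m, rfl | rfl⟩
  · rw [w_even] at h ⊢
    simp only [map_mul, map_pow, map_inv, swap_a, swap_b] at h ⊢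
    exact semiconjBy_swap_even h
  · rw [w_odd] at h ⊢
    simp only [map_mul, map_pow, map_inv, swap_a, swap_b] at h ⊢
    exact semiconjBy_swap_odd h

theorem commute_proj_longitude_a : Commute (proj k n (longitude k n)) (proj k n a) := by
  rw [longitude, map_mul]
  exact (semiconjBy_proj_swap_w_zpow k n).mul_left (semiconjBy_proj_w_zpow k n)

theorem four_dvd_exponentSum_longitude : 4 ∣ exponentSum (longitude k n) := by
  rw [longitude, exponentSum_mul, exponentSum_swap, exponentSum_zpow]
  rcases Nat.even_or_odd' k with ⟨m, rfl | rfl⟩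
  · rw [exponentSum_w_even, mul_zero, add_zero]
    exact dvd_zero 4
  · rw [exponentSum_w_odd]
    exact ⟨n, by ring⟩

end Longitude

section Riley

theorem semiconjBy_coe_of_semiconjBy_generators {R α : Type*} [CommRing R] {d : ℕ}
    {f f' : FreeGroup α →* SL(d, R)} {x : Matrix (Fin d) (Fin d) R}
    (h : ∀ y, SemiconjBy x (f (FreeGroup.of y)).1 (f' (FreeGroup.of y)).1) (g : FreeGroup α) :
    SemiconjBy x (f g).1 (f' g).1 := by
  induction g using FreeGroup.induction_on with
  | C1 => rw [map_one, map_one]; exact SemiconjBy.one_right x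
  | of y => exact h y
  | inv_of y ih =>
    rw [map_inv, map_inv]
    exact SemiconjBy.units_inv_right (x := (f (FreeGroup.of y)).toGL)
      (y := (f' (FreeGroup.of y)).toGL) ih
  | mul g g' hg hg' =>
    rw [map_mul, map_mul, Matrix.SpecialLinearGroup.coe_mul, Matrix.SpecialLinearGroup.coe_mul]
    exact hg.mul_right hg'

/-- The endomorphism of the free group exchanging `a` with `b⁻¹`. It inverts the words `w`,
which are palindromes up to exchanging `a` and `b`. -/
def swapInv : FreeGroup (Fin 2) →* FreeGroup (Fin 2) := FreeGroup.lift ![b⁻¹, a⁻¹]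

theorem swapInv_a : swapInv a = b⁻¹ := FreeGroup.lift_apply_of

theorem swapInv_b : swapInv b = a⁻¹ := FreeGroup.lift_apply_of

theorem swapInv_w (k : ℕ) : swapInv (w k) = (w k)⁻¹ := by
  have h₁ : a⁻¹ * b = (b⁻¹ * a)⁻¹ := by group
  have h₂ : a * b⁻¹ = (b * a⁻¹)⁻¹ := by group
  rcases Nat.even_or_odd' k with ⟨m, rfl | rfl⟩
  · simp only [w_even, map_mul, map_pow, map_inv, swapInv_a, swapInv_b, inv_inv, h₁, h₂, inv_pow,
      mul_inv_rev ((b * a⁻¹) ^ m)]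
  · simp only [w_odd, map_mul, map_pow, map_inv, swapInv_a, swapInv_b, inv_inv, h₁, h₂, inv_pow]
    group

variable {R : Type*} [CommRing R]

/-- The subgroup of upper unipotent matrices, parametrized by the additive group of the ring. -/
def upperUnipotent : Multiplicative R →* SL(2, R) where
  toFun x := ⟨!![1, x.toAdd; 0, 1], by
    simp only [Matrix.det_fin_two_of, mul_one, mul_zero, sub_zero]⟩
  map_one' := Subtype.ext Matrix.one_fin_two.symm
  map_mul' x y := Subtype.ext <|
    show !![1, (x * y).toAdd; 0, 1] = !![1, x.toAdd; 0, 1] * !![1, y.toAdd; 0, 1] by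
      rw [Matrix.mul_fin_two, toAdd_mul]
      simp only [mul_one, one_mul, mul_zero, zero_mul, add_zero, zero_add, add_comm]

theorem coe_upperUnipotent (x : R) :
    (upperUnipotent (Multiplicative.ofAdd x)).1 = !![1, x; 0, 1] := rfl

/-- The normal form of a pair of parabolic generators: `a ↦ [1 1; 0 1]` and `b ↦ [1 0; -u 1]`. -/
def rileyGenerator (u : R) : Fin 2 → SL(2, R) :=
  ![upperUnipotent (Multiplicative.ofAdd 1),
    ⟨!![1, 0; -u, 1], by simp only [Matrix.det_fin_two_of, mul_one, zero_mul, sub_zero]⟩]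

/-- Riley's parabolic representation of the free group, with parameter `u`. -/
def riley (u : R) : FreeGroup (Fin 2) →* SL(2, R) := FreeGroup.lift (rileyGenerator u)

theorem riley_a (u : R) : riley u a = upperUnipotent (Multiplicative.ofAdd 1) :=
  FreeGroup.lift_apply_of

theorem coe_riley_a (u : R) : (riley u a).1 = !![1, 1; 0, 1] :=
  congrArg Subtype.val (riley_a u)

theorem coe_riley_b (u : R) : (riley u b).1 = !![1, 0; -u, 1] :=
  congrArg Subtype.val (FreeGroup.lift_apply_of (f := rileyGenerator u) (x := 1))

theorem map_riley {R' : Type*} [CommRing R'] (φ : R →+* R') (u : R) (g : FreeGroup (Fin 2)) :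
    Matrix.SpecialLinearGroup.map φ (riley u g) = riley (φ u) g := by
  suffices (Matrix.SpecialLinearGroup.map φ).comp (riley u) = riley (φ u) from
    DFunLike.congr_fun this g
  refine FreeGroup.ext_hom _ _ <| Fin.forall_fin_two.2
    ⟨show Matrix.SpecialLinearGroup.map φ (riley u a) = riley (φ u) a from Subtype.ext ?_,
      show Matrix.SpecialLinearGroup.map φ (riley u b) = riley (φ u) b from Subtype.ext ?_⟩
  · rw [Matrix.SpecialLinearGroup.map_apply_coe, coe_riley_a, coe_riley_a]
    simp [← Matrix.ext_iff]
  · rw [Matrix.SpecialLinearGroup.map_apply_coe, coe_riley_b, coe_riley_b]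
    simp [← Matrix.ext_iff]

theorem riley_zero :
    riley (0 : R) = upperUnipotent.comp (FreeGroup.lift ![Multiplicative.ofAdd 1, 1]) := by
  refine FreeGroup.ext_hom _ _ <| Fin.forall_fin_two.2 ⟨?_, ?_⟩
  · rw [MonoidHom.comp_apply, FreeGroup.lift_apply_of]
    exact riley_a 0
  · rw [MonoidHom.comp_apply, FreeGroup.lift_apply_of]
    refine Subtype.ext ((coe_riley_b 0).trans ?_)
    rw [neg_zero]
    exact (coe_upperUnipotent 0).symm

theorem semiconjBy_riley_swap (u : R) (g : FreeGroup (Fin 2)) :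
    SemiconjBy !![0, 1; -u, 0] (riley u g).1 (riley u (swap g)).1 := by
  refine semiconjBy_coe_of_semiconjBy_generators (f' := (riley u).comp swap)
    (Fin.forall_fin_two.2
      ⟨show _ * (riley u a).1 = (riley u (swap a)).1 * _ from ?_,
        show _ * (riley u b).1 = (riley u (swap b)).1 * _ from ?_⟩) g
  · rw [swap_a, coe_riley_a, coe_riley_b, Matrix.mul_fin_two, Matrix.mul_fin_two]
    simp
  · rw [swap_b, coe_riley_a, coe_riley_b, Matrix.mul_fin_two, Matrix.mul_fin_two]
    simp

theorem semiconjBy_riley_swapInv (u : R) (g : FreeGroup (Fin 2)) :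
    SemiconjBy !![0, 1; u, 0] (riley u (swapInv g)).1 (riley u g).1 := by
  refine semiconjBy_coe_of_semiconjBy_generators (f := (riley u).comp swapInv)
    (Fin.forall_fin_two.2
      ⟨show _ * (riley u (swapInv a)).1 = (riley u a).1 * _ from ?_,
        show _ * (riley u (swapInv b)).1 = (riley u b).1 * _ from ?_⟩) g
  · rw [swapInv_a, map_inv, Matrix.SpecialLinearGroup.coe_inv, coe_riley_a, coe_riley_b,
      Matrix.adjugate_fin_two_of, Matrix.mul_fin_two, Matrix.mul_fin_two]
    simp
  · rw [swapInv_b, map_inv, Matrix.SpecialLinearGroup.coe_inv, coe_riley_a, coe_riley_b,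
      Matrix.adjugate_fin_two_of, Matrix.mul_fin_two, Matrix.mul_fin_two]
    simp

theorem riley_w_zpow_one_zero (u : R) (k : ℕ) (n : ℤ) :
    (riley u (w k ^ n)).1 1 0 = -u * (riley u (w k ^ n)).1 0 1 := by
  have h := semiconjBy_riley_swapInv u (w k ^ n)
  rw [map_zpow swapInv, swapInv_w, inv_zpow, map_inv, Matrix.SpecialLinearGroup.coe_inv] at h
  rw [Matrix.adjugate_fin_two, SemiconjBy, Matrix.eta_fin_two (riley u (w k ^ n)).1,
    Matrix.mul_fin_two, Matrix.mul_fin_two] at h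
  generalize (riley u (w k ^ n)).1 = v at *
  have h₀₀ : 0 * v 1 1 + 1 * -v 1 0 = v 0 0 * 0 + v 0 1 * u := congrFun₂ h 0 0
  linear_combination -h₀₀

variable {u : R} {k : ℕ} {n : ℤ}

theorem riley_r (h : (riley u (w k ^ n)).1 0 0 = 0) : riley u (r k n) = 1 := by
  have h₁₀ := riley_w_zpow_one_zero u k n
  have hv : riley u (w k ^ n) * riley u a = riley u b * riley u (w k ^ n) := by
    generalize riley u (w k ^ n) = v at *
    refine Subtype.ext ?_
    rw [Matrix.SpecialLinearGroup.coe_mul, Matrix.SpecialLinearGroup.coe_mul, coe_riley_a,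
      coe_riley_b, Matrix.eta_fin_two v.1, h, h₁₀, Matrix.mul_fin_two, Matrix.mul_fin_two]
    simp
  rw [r_eq_conj_mul_inv, map_mul, map_mul, map_mul, map_inv, map_inv, hv, mul_inv_cancel_right,
    mul_inv_cancel]

/-- The parabolic representation of the knot group attached to a zero `u` of the Riley polynomial
`(riley u (w k ^ n)).1 0 0`. -/
def rileyRep (h : (riley u (w k ^ n)).1 0 0 = 0) : KnotGroup k n →* SL(2, R) :=
  PresentedGroup.toGroup (f := rileyGenerator u) fun _ hs =>
    (congrArg (riley u) (Set.mem_singleton_iff.1 hs)).trans (riley_r h)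

theorem rileyRep_proj (h : (riley u (w k ^ n)).1 0 0 = 0) (g : FreeGroup (Fin 2)) :
    rileyRep h (proj k n g) = riley u g := rfl

theorem mul_sq_riley_w_zpow_eq_one (h : (riley u (w k ^ n)).1 0 0 = 0) :
    u * (riley u (w k ^ n)).1 0 1 ^ 2 = 1 := by
  linear_combination entries_mul_sub_eq_one (riley u (w k ^ n)) - (riley u (w k ^ n)).1 1 1 * h +
    (riley u (w k ^ n)).1 0 1 * riley_w_zpow_one_zero u k n

theorem coe_riley_longitude (h : (riley u (w k ^ n)).1 0 0 = 0) :
    (riley u (longitude k n)).1 =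
      !![-1, 2 * (riley u (w k ^ n)).1 0 1 * (riley u (w k ^ n)).1 1 1; 0, -1] := by
  have h₁₀ := riley_w_zpow_one_zero u k n
  have hdet := mul_sq_riley_w_zpow_eq_one h
  have hu : IsUnit u := .of_mul_eq_one _ hdet
  have hV := (semiconjBy_riley_swap u (w k ^ n)).eq
  rw [longitude, map_mul, Matrix.SpecialLinearGroup.coe_mul]
  generalize (riley u (swap (w k ^ n))).1 = V at *
  generalize (riley u (w k ^ n)).1 = v at *
  rw [Matrix.eta_fin_two V, Matrix.eta_fin_two v, Matrix.mul_fin_two, Matrix.mul_fin_two] at hV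
  simp only [h, h₁₀, EmbeddingLike.apply_eq_iff_eq, Matrix.vecCons_inj, zero_mul, mul_zero, one_mul,
    mul_one, zero_add, add_zero, and_true, mul_neg, neg_mul, neg_inj] at hV
  obtain ⟨⟨hV₀₁, hV₀₀⟩, hV₁₁, hV₁₀⟩ := hV
  rw [mul_comm, hu.mul_left_inj] at hV₀₁
  rw [eq_comm, hu.mul_left_eq_zero] at hV₁₁
  calc V * v = !![v 1 1, v 0 1; -(u * v 0 1), 0] * !![0, v 0 1; -u * v 0 1, v 1 1] :=
        congrArg₂ _ ((Matrix.eta_fin_two V).trans (by rw [hV₀₀, hV₁₀, hV₀₁, hV₁₁]))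
          ((Matrix.eta_fin_two v).trans (by rw [h, h₁₀]))
    _ = !![-(u * v 0 1 ^ 2), 2 * v 0 1 * v 1 1; 0, -(u * v 0 1 ^ 2)] := by
        rw [Matrix.mul_fin_two]
        simp only [EmbeddingLike.apply_eq_iff_eq, Matrix.vecCons_inj, and_true]
        refine ⟨⟨?_, ?_⟩, ?_, ?_⟩ <;> ring
    _ = !![-1, 2 * v 0 1 * v 1 1; 0, -1] := by rw [hdet]

theorem riley_longitude_sq (h : (riley u (w k ^ n)).1 0 0 = 0) :
    riley u (longitude k n) ^ 2 = upperUnipotent (Multiplicative.ofAdd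
      (-4 * (riley u (w k ^ n)).1 0 1 * (riley u (w k ^ n)).1 1 1)) := by
  refine Subtype.ext ?_
  rw [sq, Matrix.SpecialLinearGroup.coe_mul, coe_riley_longitude h, coe_upperUnipotent,
    Matrix.mul_fin_two]
  simp only [EmbeddingLike.apply_eq_iff_eq, Matrix.vecCons_inj, and_true]
  refine ⟨⟨?_, ?_⟩, ?_, ?_⟩ <;> ring

end Riley

section LongitudeOrder

open Polynomial (X C)

theorem degree_chebyshev_S (R : Type*) [CommRing R] [Nontrivial R] (p : ℕ) :
    (Polynomial.Chebyshev.S R p).degree = p ∧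
      (Polynomial.Chebyshev.S R ((p : ℤ) - 1)).degree < p := by
  induction p with
  | zero => simp
  | succ p ih =>
    obtain ⟨h, h'⟩ := ih
    have hX : (X * Polynomial.Chebyshev.S R p).degree = (p + 1 : WithBot ℕ) := by
      rw [mul_comm, Polynomial.degree_mul_X, h]
    have hlt : (p : WithBot ℕ) < p + 1 := by exact_mod_cast p.lt_succ_self
    rw [Nat.cast_succ, Nat.cast_succ, add_sub_cancel_right, h, Polynomial.Chebyshev.S_add_one]
    refine ⟨?_, hlt⟩
    rw [Polynomial.degree_sub_eq_left_of_degree_lt (hX ▸ h'.trans hlt), hX]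

theorem coe_riley_mul {R : Type*} [CommRing R] (u : R) :
    (riley u (b * a)).1 = !![1, 1; -u, 1 - u] := by
  rw [map_mul, Matrix.SpecialLinearGroup.coe_mul, coe_riley_a, coe_riley_b, Matrix.mul_fin_two]
  simp only [EmbeddingLike.apply_eq_iff_eq, Matrix.vecCons_inj, and_true]
  refine ⟨⟨?_, ?_⟩, ?_, ?_⟩ <;> ring

theorem trace_riley_mul {R : Type*} [CommRing R] (u : R) :
    (riley u (b * a)).1.trace = 2 - u := by
  rw [coe_riley_mul, Matrix.trace_fin_two_of]
  ring

section Field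

variable {K : Type*} [Field K]

theorem exists_riley_mul_pow_one_one_eq_zero [IsAlgClosed K] {p : ℕ} (hp : p ≠ 0) :
    ∃ u : K, (riley u (b * a) ^ p).1 1 1 = 0 := by
  obtain ⟨h, h'⟩ := degree_chebyshev_S K p
  have hdeg : (Polynomial.Chebyshev.S K p - Polynomial.Chebyshev.S K ((p : ℤ) - 1)).degree ≠ 0 := by
    rw [Polynomial.degree_sub_eq_left_of_degree_lt (h ▸ h'), h]
    exact_mod_cast hp
  obtain ⟨t, ht⟩ := IsAlgClosed.exists_root _ hdeg
  rw [Polynomial.IsRoot, Polynomial.Chebyshev.S_eq] at ht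
  refine ⟨2 - t, ?_⟩
  rw [coe_pow_eq_chebyshev, trace_riley_mul, coe_riley_mul, sub_sub_cancel]
  simp only [Polynomial.eval_sub, Polynomial.eval_mul, Polynomial.eval_X, Matrix.smul_of,
    Matrix.smul_cons, smul_eq_mul, mul_one, Matrix.smul_empty, Fin.isValue, Matrix.sub_apply,
    Matrix.of_apply, Matrix.cons_val', Matrix.cons_val_one, Matrix.cons_val_fin_one,
    Matrix.smul_apply, Matrix.one_apply_eq, neg_sub] at ht ⊢
  linear_combination ht

theorem riley_mul_pow_diagonal_ne_zero {u : K} {p : ℕ}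
    (h₀₀ : (riley u (b * a) ^ p).1 0 0 = 0) : (riley u (b * a) ^ p).1 1 1 ≠ 0 := by
  intro h₁₁
  have hdet := entries_mul_sub_eq_one (riley u (b * a) ^ p)
  have h : (riley u (b * a) ^ p).1 0 0 - (riley u (b * a) ^ p).1 1 1 +
      (riley u (b * a) ^ p).1 1 0 = 0 := by
    rw [coe_pow_eq_chebyshev, coe_riley_mul]
    simp only [Matrix.trace_fin_two_of, Matrix.smul_of, Matrix.smul_cons, smul_eq_mul, mul_one,
      Matrix.smul_empty, mul_neg, Fin.isValue, Matrix.sub_apply, Matrix.of_apply, Matrix.cons_val',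
      Matrix.cons_val_zero, Matrix.cons_val_fin_one, Matrix.smul_apply, Matrix.one_apply_eq,
      Matrix.cons_val_one, ne_eq, one_ne_zero, not_false_eq_true, Matrix.one_apply_ne, mul_zero,
      sub_zero]
    ring
  rw [h₀₀, h₁₁, sub_self, zero_add] at h
  rw [h₀₀, h] at hdet
  simp at hdet

variable [CharP K 2]

theorem riley_w_of_char_two (u : K) (k : ℕ) : riley u (w k) = riley u (b * a) ^ k := by
  have ha : (riley u a)⁻¹ = riley u a := by
    refine Subtype.ext ?_
    rw [Matrix.SpecialLinearGroup.coe_inv, coe_riley_a, Matrix.adjugate_fin_two_of, CharTwo.neg_eq,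
      neg_zero]
  have hb : (riley u b)⁻¹ = riley u b := by
    refine Subtype.ext ?_
    rw [Matrix.SpecialLinearGroup.coe_inv, coe_riley_b, Matrix.adjugate_fin_two_of, neg_zero,
      CharTwo.neg_eq]
  rcases Nat.even_or_odd' k with ⟨m, rfl | rfl⟩
  · rw [w_even]
    simp only [map_mul, map_pow, map_inv, ha, hb, ← pow_add, two_mul]
  · rw [w_odd]
    simp only [map_mul, map_pow, map_inv, ha, hb, ← pow_add, ← pow_succ]
    ring_nf

theorem riley_w_zpow_of_char_two (u : K) (k N : ℕ) :
    riley u (w k ^ (-N : ℤ)) = (riley u (b * a) ^ (k * N))⁻¹ := by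
  rw [map_zpow, riley_w_of_char_two, zpow_neg, zpow_natCast, pow_mul]

theorem exists_riley_w_zpow_of_char_two [IsAlgClosed K] {k N : ℕ} (hk : k ≠ 0) (hN : N ≠ 0) :
    ∃ u : K, (riley u (w k ^ (-N : ℤ))).1 0 0 = 0 ∧ (riley u (w k ^ (-N : ℤ))).1 1 1 ≠ 0 := by
  obtain ⟨u, hu⟩ := exists_riley_mul_pow_one_one_eq_zero (K := K) (mul_ne_zero hk hN)
  refine ⟨u, ?_⟩
  rw [riley_w_zpow_of_char_two, Matrix.SpecialLinearGroup.coe_inv, Matrix.adjugate_fin_two]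
  exact ⟨hu, fun h => riley_mul_pow_diagonal_ne_zero h hu⟩

end Field

/-- The Riley polynomial, whose zeros parametrize the parabolic representations of the knot
group. -/
def rileyPolynomial (k : ℕ) (n : ℤ) : Polynomial ℤ := (riley (X : Polynomial ℤ) (w k ^ n)).1 0 0

theorem map_rileyPolynomial {R : Type*} [CommRing R] (φ : Polynomial ℤ →+* R) (k : ℕ) (n : ℤ) :
    φ (rileyPolynomial k n) = (riley (φ X) (w k ^ n)).1 0 0 := by
  rw [← map_riley]
  rfl

theorem eval_zero_rileyPolynomial (k : ℕ) (n : ℤ) : (rileyPolynomial k n).eval 0 = 1 := by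
  rw [← Polynomial.coe_evalRingHom, map_rileyPolynomial, Polynomial.coe_evalRingHom,
    Polynomial.eval_X, riley_zero]
  rfl

theorem dvd_of_dvd_C_mul {f p : Polynomial ℤ} {j : ℤ} (hf : f.eval 0 = 1) (hj : j ≠ 0)
    (h : f ∣ C j * p) : f ∣ p := by
  refine IsRelPrime.dvd_of_dvd_mul_left (fun d hdf hdj => ?_) h
  have hd : d.natDegree = 0 := by
    rw [← Nat.le_zero, ← Polynomial.natDegree_C j]
    exact Polynomial.natDegree_le_of_dvd hdj (Polynomial.C_ne_zero.2 hj)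
  obtain ⟨c, rfl⟩ := Polynomial.natDegree_eq_zero.1 hd
  have hc := Polynomial.eval_dvd (x := 0) hdf
  rw [hf, Polynomial.eval_C] at hc
  exact (isUnit_of_dvd_one hc).map C

/-- The coordinate ring of the scheme of parabolic representations over `ℤ`. -/
abbrev RileyRing (k : ℕ) (n : ℤ) : Type := AdjoinRoot (rileyPolynomial k n)

variable {k : ℕ} {n : ℤ}

theorem rileyRing_eq_zero_of_intCast_mul {j : ℤ} (hj : j ≠ 0) {x : RileyRing k n}
    (h : (j : RileyRing k n) * x = 0) : x = 0 := by
  obtain ⟨p, rfl⟩ := AdjoinRoot.mk_surjective x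
  have hC : (j : RileyRing k n) = AdjoinRoot.mk (rileyPolynomial k n) (C j) :=
    (map_intCast ((AdjoinRoot.mk (rileyPolynomial k n)).comp C) j).symm
  rw [hC, ← map_mul, AdjoinRoot.mk_eq_zero] at h
  exact AdjoinRoot.mk_eq_zero.2 (dvd_of_dvd_C_mul (eval_zero_rileyPolynomial k n) hj h)

theorem riley_root_w_zpow :
    (riley (AdjoinRoot.root (rileyPolynomial k n)) (w k ^ n)).1 0 0 = 0 := by
  rw [← AdjoinRoot.mk_X, ← map_rileyPolynomial, AdjoinRoot.mk_self]

theorem exists_rileyRing_hom {N : ℕ} (hk : k ≠ 0) (hN : N ≠ 0) (hn : n = -N) :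
    ∃ φ : RileyRing k n →+* AlgebraicClosure (ZMod 2),
      φ ((riley (AdjoinRoot.root (rileyPolynomial k n)) (w k ^ n)).1 1 1) ≠ 0 := by
  obtain ⟨u, h₀₀, h₁₁⟩ :=
    exists_riley_w_zpow_of_char_two (K := AlgebraicClosure (ZMod 2)) hk hN
  rw [← hn] at h₀₀ h₁₁
  have h := map_rileyPolynomial (Polynomial.eval₂RingHom (Int.castRingHom _) u) k n
  rw [Polynomial.coe_eval₂RingHom, Polynomial.eval₂_X, h₀₀] at h
  refine ⟨AdjoinRoot.lift (Int.castRingHom _) u h, ?_⟩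
  rwa [← AdjoinRoot.lift_root h, ← map_riley] at h₁₁

theorem two_mul_eq_of_zpow_mul_longitude_zpow_eq_one {R : Type*} [CommRing R] {u : R}
    (hu : (riley u (w k ^ n)).1 0 0 = 0) {i j : ℤ}
    (h : proj k n a ^ i * proj k n (longitude k n) ^ j = 1) :
    (i : R) * 2 = j * (4 * (riley u (w k ^ n)).1 0 1 * (riley u (w k ^ n)).1 1 1) := by
  have hcomm : Commute (riley u a ^ i) (riley u (longitude k n) ^ j) :=
    ((commute_proj_longitude_a k n).symm.map (rileyRep hu)).zpow_zpow i j
  have hrep : riley u a ^ i * riley u (longitude k n) ^ j = 1 := by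
    rw [← rileyRep_proj hu a, ← rileyRep_proj hu, ← map_zpow (rileyRep hu),
      ← map_zpow (rileyRep hu), ← map_mul, h, map_one]
  have hsq : (riley u a ^ 2) ^ i * (riley u (longitude k n) ^ 2) ^ j = 1 := by
    rw [← zpow_natCast, ← zpow_natCast, zpow_comm, zpow_comm _ _ j, ← hcomm.mul_zpow, hrep,
      one_zpow]
  rw [riley_a, riley_longitude_sq hu, ← map_pow, ← map_zpow, ← map_zpow, ← map_mul] at hsq
  have h₀₁ : i • (2 • (1 : R)) +
      j • (-4 * (riley u (w k ^ n)).1 0 1 * (riley u (w k ^ n)).1 1 1) = 0 :=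
    congrFun₂ (congrArg Subtype.val hsq) 0 1
  rw [zsmul_eq_mul, zsmul_eq_mul, nsmul_eq_mul, Nat.cast_ofNat, mul_one] at h₀₁
  linear_combination h₀₁

theorem eq_zero_of_zpow_mul_longitude_zpow_eq_one {N : ℕ} (hk : k ≠ 0) (hN : N ≠ 0) (hn : n = -N)
    {i j : ℤ} (h : proj k n a ^ i * proj k n (longitude k n) ^ j = 1) : i = 0 ∧ j = 0 := by
  obtain ⟨s, hs⟩ := four_dvd_exponentSum_longitude k n
  have hsum : i + j * (4 * s) = 0 := by
    have : exponentSum (a ^ i * longitude k n ^ j) = 0 := by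
      rw [← abel_proj (k := k) (n := n), map_mul (proj k n), map_zpow, map_zpow, h,
        map_one, toAdd_one]
    rwa [exponentSum_mul, exponentSum_zpow, exponentSum_zpow, exponentSum_a, mul_one, hs] at this
  suffices hj : j = 0 by
    rw [hj, zero_mul, add_zero] at hsum
    exact ⟨hsum, hj⟩
  by_contra hj
  obtain ⟨φ, hφ⟩ := exists_rileyRing_hom hk hN hn
  have hdet := mul_sq_riley_w_zpow_eq_one (riley_root_w_zpow (k := k) (n := n))
  have hsq := two_mul_eq_of_zpow_mul_longitude_zpow_eq_one riley_root_w_zpow h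
  generalize riley (AdjoinRoot.root (rileyPolynomial k n)) (w k ^ n) = v at *
  have hv : v.1 0 1 * v.1 1 1 + 2 * s = 0 := by
    refine rileyRing_eq_zero_of_intCast_mul (mul_ne_zero four_ne_zero hj) ?_
    have hsum' : (i + j * (4 * s) : RileyRing k n) = 0 := by
      simpa only [Int.cast_add, Int.cast_mul, Int.cast_ofNat, Int.cast_zero] using
        congrArg (Int.cast : ℤ → RileyRing k n) hsum
    push_cast
    linear_combination 2 * hsum' - hsq
  have hφv := congrArg φ hv
  rw [map_add, map_mul, two_mul, map_add, CharTwo.add_self_eq_zero, add_zero, map_zero, mul_eq_zero,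
    or_iff_left hφ] at hφv
  have hφdet := congrArg φ hdet
  rw [map_mul, map_pow, hφv, zero_pow two_ne_zero, mul_zero, map_one] at hφdet
  exact zero_ne_one hφdet

theorem proj_a_ne_proj_b {N : ℕ} (hk : k ≠ 0) (hN : N ≠ 0) (hn : n = -N) :
    proj k n a ≠ proj k n b := by
  intro h
  obtain ⟨φ, -⟩ := exists_rileyRing_hom hk hN hn
  have hab := congrArg (fun g => (rileyRep (riley_root_w_zpow (k := k) (n := n)) g).1) h
  rw [rileyRep_proj, rileyRep_proj, coe_riley_a, coe_riley_b] at hab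
  have h₀₁ : (1 : RileyRing k n) = 0 := congrFun₂ hab 0 1
  have hφ := congrArg φ h₀₁
  rw [map_one, map_zero] at hφ
  exact one_ne_zero hφ

end LongitudeOrder

section Diagonal

variable {K : Type*} [Field K]

/-- The diagonal torus `x ↦ diag (x, x⁻¹)` of `SL₂`. -/
def diagonalTorus : Kˣ →* SL(2, K) where
  toFun x := ⟨!![(x : K), 0; 0, (x⁻¹ : Kˣ)], by
    rw [Matrix.det_fin_two_of, Units.mul_inv, mul_zero, sub_zero]⟩
  map_one' := Subtype.ext <| show !![((1 : Kˣ) : K), 0; 0, ((1⁻¹ : Kˣ) : K)] = 1 by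
    rw [inv_one, Units.val_one, Matrix.one_fin_two]
  map_mul' x y := Subtype.ext <|
    show !![((x * y : Kˣ) : K), 0; 0, ((x * y)⁻¹ : Kˣ)] =
      !![(x : K), 0; 0, (x⁻¹ : Kˣ)] * !![(y : K), 0; 0, (y⁻¹ : Kˣ)] by
      rw [Matrix.mul_fin_two, mul_inv, Units.val_mul, Units.val_mul]
      simp only [mul_zero, zero_mul, add_zero, zero_add]

theorem coe_diagonalTorus (x : Kˣ) :
    (diagonalTorus x).1 = !![(x : K), 0; 0, (x⁻¹ : Kˣ)] := rfl

theorem continuous_diagonalTorus [TopologicalSpace K] : Continuous (diagonalTorus (K := K)) := by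
  refine Continuous.subtype_mk (continuous_matrix fun i j => ?_) _
  fin_cases i <;> fin_cases j
  · exact Units.continuous_val
  · exact continuous_const
  · exact continuous_const
  · exact Units.continuous_coe_inv

theorem exists_eq_diagonalTorus {g : SL(2, K)} (h₀₁ : g.1 0 1 = 0) (h₁₀ : g.1 1 0 = 0) :
    ∃ x, g = diagonalTorus x := by
  have hdet := entries_mul_sub_eq_one g
  rw [h₀₁, zero_mul, sub_zero] at hdet
  refine ⟨⟨g.1 0 0, g.1 1 1, hdet, (mul_comm _ _).trans hdet⟩, Subtype.ext ?_⟩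
  exact (Matrix.eta_fin_two g.1).trans (by rw [h₀₁, h₁₀]; rfl)

theorem exists_eq_conj_diagonalTorus_of_isUpperTriangular {t : SL(2, K)} (ht : t.1 1 0 = 0)
    (hne : t.1 1 1 ≠ t.1 0 0) :
    ∃ (p : SL(2, K)) (x : Kˣ), t = p * diagonalTorus x * p⁻¹ ∧ (x : K) ≠ (x⁻¹ : Kˣ) := by
  have hdet := entries_mul_sub_eq_one t
  rw [ht, mul_zero, sub_zero] at hdet
  let x : Kˣ := ⟨t.1 0 0, t.1 1 1, hdet, (mul_comm _ _).trans hdet⟩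
  have hsub : t.1 1 1 - t.1 0 0 ≠ 0 := sub_ne_zero.2 hne
  set p : SL(2, K) := upperUnipotent (Multiplicative.ofAdd (t.1 0 1 / (t.1 1 1 - t.1 0 0))) with hp
  have hcomm : t * p = p * diagonalTorus x := by
    refine Subtype.ext ?_
    rw [Matrix.SpecialLinearGroup.coe_mul, Matrix.SpecialLinearGroup.coe_mul, coe_diagonalTorus,
      Matrix.eta_fin_two t.1, ht, hp, coe_upperUnipotent, Matrix.mul_fin_two, Matrix.mul_fin_two]
    have hentry : t.1 0 0 * (t.1 0 1 / (t.1 1 1 - t.1 0 0)) + t.1 0 1 =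
        t.1 0 1 / (t.1 1 1 - t.1 0 0) * t.1 1 1 := by
      field_simp
      ring
    simpa [x] using hentry
  exact ⟨p, x, eq_mul_inv_of_mul_eq hcomm, hne.symm⟩

theorem exists_eq_conj_diagonalTorus [IsAlgClosed K] {g : SL(2, K)} (h : g.1.trace ^ 2 ≠ 4) :
    ∃ (p : SL(2, K)) (x : Kˣ), g = p * diagonalTorus x * p⁻¹ ∧ (x : K) ≠ (x⁻¹ : Kˣ) := by
  obtain ⟨q, t, rfl, ht⟩ := exists_eq_conj_isUpperTriangular g
  have hdet := entries_mul_sub_eq_one t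
  rw [trace_conj, Matrix.trace_fin_two] at h
  have hne : t.1 1 1 ≠ t.1 0 0 := fun h₀ => h <| by
    linear_combination (t.1 1 1 - t.1 0 0) * h₀ + 4 * hdet + 4 * t.1 0 1 * ht
  obtain ⟨p, x, rfl, hx⟩ := exists_eq_conj_diagonalTorus_of_isUpperTriangular ht hne
  exact ⟨q * p, x, by group, hx⟩

theorem exists_eq_diagonalTorus_of_commute {g : SL(2, K)} {x : Kˣ} (hx : (x : K) ≠ (x⁻¹ : Kˣ))
    (h : Commute g (diagonalTorus x)) : ∃ y, g = diagonalTorus y := by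
  have hmul := congrArg Subtype.val h.eq
  rw [Matrix.SpecialLinearGroup.coe_mul, Matrix.SpecialLinearGroup.coe_mul, coe_diagonalTorus,
    Matrix.eta_fin_two g.1, Matrix.mul_fin_two, Matrix.mul_fin_two] at hmul
  have h₀₁ : g.1 0 0 * 0 + g.1 0 1 * (x⁻¹ : Kˣ) = x * g.1 0 1 + 0 * g.1 1 1 := congrFun₂ hmul 0 1
  have h₁₀ : g.1 1 0 * x + g.1 1 1 * 0 = 0 * g.1 0 0 + (x⁻¹ : Kˣ) * g.1 1 0 := congrFun₂ hmul 1 0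
  have hx' : (x : K) - (x⁻¹ : Kˣ) ≠ 0 := sub_ne_zero.2 hx
  refine exists_eq_diagonalTorus (mul_left_cancel₀ hx' ?_) (mul_left_cancel₀ hx' ?_)
  · linear_combination -h₀₁
  · linear_combination h₁₀

end Diagonal

section Discrete

theorem infinite_setOf_abs_mul_add_mul_le (α β : ℝ) :
    {p : ℤ × ℤ | |p.1 * α + p.2 * β| ≤ |α|}.Infinite := by
  rcases eq_or_ne α 0 with rfl | hα
  · refine Set.infinite_of_injective_forall_mem (f := fun i : ℤ => (i, (0 : ℤ)))
      (fun i j h => congrArg Prod.fst h) fun i => ?_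
    simp
  · refine Set.infinite_of_injective_forall_mem (f := fun j : ℤ => (round (-(j * β) / α), j))
      (fun i j h => congrArg Prod.snd h) fun j => ?_
    have hround : round (-(j * β) / α) * α + j * β =
        -((-(j * β) / α - round (-(j * β) / α)) * α) := by
      field_simp
      ring
    rw [Set.mem_ofPred_eq, hround, abs_neg, abs_mul]
    exact mul_le_of_le_one_left (abs_nonneg α) ((abs_sub_round _).trans (by norm_num))

theorem isCompact_setOf_abs_log_norm_le (c : ℝ) :
    IsCompact {x : ℂˣ | |Real.log ‖(x : ℂ)‖| ≤ c} := by
  have hball : IsCompact ((Units.embedProduct ℂ) ⁻¹'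
      (Metric.closedBall (0 : ℂ) (Real.exp c) ×ˢ
        (MulOpposite.unop ⁻¹' Metric.closedBall (0 : ℂ) (Real.exp c)))) :=
    Units.isClosedEmbedding_embedProduct.isCompact_preimage <|
      (isCompact_closedBall _ _).prod <|
        MulOpposite.opHomeomorph.symm.isClosedEmbedding.isCompact_preimage
          (isCompact_closedBall _ _)
  refine hball.of_isClosed_subset (isClosed_le ?_ continuous_const) fun x hx => ?_
  · exact (Units.continuous_val.norm.log fun x => norm_ne_zero_iff.2 x.ne_zero).abs
  · have hpos : 0 < ‖(x : ℂ)‖ := norm_pos_iff.2 x.ne_zero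
    obtain ⟨hlow, hhigh⟩ := abs_le.1 (Set.mem_ofPred_eq ▸ hx)
    refine ⟨mem_closedBall_zero_iff.2 ?_, mem_closedBall_zero_iff.2 ?_⟩
    · exact (Real.log_le_iff_le_exp hpos).1 hhigh
    · change ‖((x⁻¹ : ℂˣ) : ℂ)‖ ≤ _
      rw [Units.val_inv_eq_inv_val, norm_inv, ← Real.log_le_iff_le_exp (inv_pos.2 hpos),
        Real.log_inv]
      exact neg_le.1 hlow

theorem exists_map_zpow_mul_zpow_eq_one_of_discrete {G : Type*} [Group G] [TopologicalSpace G]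
    [IsTopologicalGroup G] [T2Space G] {H : Subgroup G} (hH : DiscreteTopology H) {f : ℂˣ →* G}
    (hf : Continuous f) {x y : ℂˣ} (hx : f x ∈ H) (hy : f y ∈ H) :
    ∃ i j : ℤ, (i ≠ 0 ∨ j ≠ 0) ∧ f x ^ i * f y ^ j = 1 := by
  set c := |Real.log ‖(x : ℂ)‖|
  have hfin : (f '' {z : ℂˣ | |Real.log ‖(z : ℂ)‖| ≤ c} ∩ H).Finite := by
    have hcompact := ((isCompact_setOf_abs_log_norm_le c).image hf).inter_right
      (Subgroup.isClosed_of_discrete (H := H))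
    exact hcompact.finite (IsDiscrete.mono ⟨hH⟩ Set.inter_subset_right)
  have hmaps : Set.MapsTo (fun p : ℤ × ℤ => f (x ^ p.1 * y ^ p.2))
      {p | |p.1 * Real.log ‖(x : ℂ)‖ + p.2 * Real.log ‖(y : ℂ)‖| ≤ c}
      (f '' {z : ℂˣ | |Real.log ‖(z : ℂ)‖| ≤ c} ∩ H) := by
    refine fun p hp => ⟨Set.mem_image_of_mem f ?_, ?_⟩
    · have hx₀ : ‖(x : ℂ)‖ ≠ 0 := norm_ne_zero_iff.2 x.ne_zero
      have hy₀ : ‖(y : ℂ)‖ ≠ 0 := norm_ne_zero_iff.2 y.ne_zero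
      rwa [Set.mem_ofPred_eq, Units.val_mul, Units.val_zpow_eq_zpow_val, Units.val_zpow_eq_zpow_val,
        norm_mul, norm_zpow, norm_zpow, Real.log_mul (zpow_ne_zero _ hx₀) (zpow_ne_zero _ hy₀),
        Real.log_zpow, Real.log_zpow]
    · change f (x ^ p.1 * y ^ p.2) ∈ H
      rw [map_mul, map_zpow, map_zpow]
      exact H.mul_mem (H.zpow_mem hx _) (H.zpow_mem hy _)
  obtain ⟨p, -, q, -, hpq, heq⟩ :=
    (infinite_setOf_abs_mul_add_mul_le _ _).exists_ne_map_eq_of_mapsTo hmaps hfin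
  refine ⟨p.1 - q.1, p.2 - q.2, ?_, ?_⟩
  · rw [sub_ne_zero, sub_ne_zero, ← not_and_or]
    exact fun h => hpq (Prod.ext h.1 h.2)
  · rw [← map_zpow, ← map_zpow, ← map_mul, zpow_sub, zpow_sub, mul_mul_mul_comm, ← mul_inv,
      map_mul, heq, map_inv, mul_inv_cancel]

theorem exists_zpow_mul_zpow_eq_one_of_discrete {H : Subgroup SL(2, ℂ)} (hH : DiscreteTopology H)
    {g l : SL(2, ℂ)} (hg : g ∈ H) (hl : l ∈ H) (h : Commute l g) (htr : g.1.trace ^ 2 ≠ 4) :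
    ∃ i j : ℤ, (i ≠ 0 ∨ j ≠ 0) ∧ g ^ i * l ^ j = 1 := by
  obtain ⟨p, x, rfl, hx⟩ := exists_eq_conj_diagonalTorus htr
  obtain ⟨y, hy⟩ : ∃ y, p⁻¹ * l * p = diagonalTorus y := by
    refine exists_eq_diagonalTorus_of_commute hx ?_
    have hconj := h.map (MulAut.conj p⁻¹)
    rwa [MulAut.conj_apply, MulAut.conj_apply, inv_inv,
      show p⁻¹ * (p * diagonalTorus x * p⁻¹) * p = diagonalTorus x by group] at hconj
  obtain rfl : l = p * diagonalTorus y * p⁻¹ := by rw [← hy]; group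
  exact exists_map_zpow_mul_zpow_eq_one_of_discrete hH
    (f := (MulAut.conj p).toMonoidHom.comp diagonalTorus)
    ((continuous_const.mul continuous_diagonalTorus).mul continuous_const) hg hl

end Discrete

section Holonomy

variable {k : ℕ} {n : ℤ} {ρ : KnotGroup k n →* SL(2, ℂ)}

theorem IsHolonomy.injective (h : IsHolonomy ρ) : Function.Injective ρ := by
  have hcomp := h.faithful
  rw [MonoidHom.coe_comp] at hcomp
  exact hcomp.of_comp

theorem IsHolonomy.isNonabelianParabolic (h : IsHolonomy ρ) (hk : k ≠ 0) (hn : n < 0) :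
    IsNonabelianParabolic ρ := by
  have hnN : n = -n.natAbs := by omega
  have hN : n.natAbs ≠ 0 := by omega
  refine ⟨⟨proj k n (w k ^ n), proj k n a, fun hcomm => ?_⟩, ?_⟩
  · rw [← map_mul ρ, ← map_mul ρ] at hcomm
    have hab := (semiconjBy_proj_w_zpow k n).eq
    rw [h.injective hcomm] at hab
    exact proj_a_ne_proj_b hk hN hnN (mul_right_cancel hab)
  · by_contra! htr
    have htr₂ : (ρ (proj k n a)).1.trace ^ 2 ≠ 4 := fun hsq => by
      rcases sq_eq_sq_iff_eq_or_eq_neg.1 (hsq.trans (by norm_num : (4 : ℂ) = 2 ^ 2)) with h₂ | h₂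
      exacts [htr.1 h₂, htr.2 h₂]
    obtain ⟨i, j, hij, hrel⟩ := exists_zpow_mul_zpow_eq_one_of_discrete h.discrete
      (MonoidHom.mem_range.2 ⟨proj k n a, rfl⟩)
      (MonoidHom.mem_range.2 ⟨proj k n (longitude k n), rfl⟩)
      ((commute_proj_longitude_a k n).map ρ) htr₂
    rw [← map_zpow ρ, ← map_zpow ρ, ← map_mul ρ, map_eq_one_iff ρ h.injective] at hrel
    exact hij.elim (· (eq_zero_of_zpow_mul_longitude_zpow_eq_one hk hN hnN hrel).1)
      (· (eq_zero_of_zpow_mul_longitude_zpow_eq_one hk hN hnN hrel).2)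

end Holonomy

end DoubleTwist

end

theorem proposition3p7_general (k : ℕ) (n : ℤ) (hn : n ≤ -1)
    (ρ : DoubleTwist.KnotGroup k n →* Matrix.SpecialLinearGroup (Fin 2) ℂ)
    (hρ : DoubleTwist.IsNonabelianParabolic ρ) :
    (∀ m : ℕ, k = 2 * m →
      DoubleTwist.HasExtremeTerms (DoubleTwist.adjointTwistedAlexander ρ)
        ((m : ℂ) * ((|n| : ℤ) : ℂ) * DoubleTwist.S ((m : ℤ) - 1) (DoubleTwist.yTrace ρ) ^ 2 *
          DoubleTwist.S (|n| - 1) (DoubleTwist.zTrace ρ) ^ 2) 0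
        (-((m : ℂ) * ((|n| : ℤ) : ℂ) * DoubleTwist.S ((m : ℤ) - 1) (DoubleTwist.yTrace ρ) ^ 2 *
          DoubleTwist.S (|n| - 1) (DoubleTwist.zTrace ρ) ^ 2)) (-3)) ∧
    (∀ m : ℕ, k = 2 * m + 1 →
      DoubleTwist.HasExtremeTerms (DoubleTwist.adjointTwistedAlexander ρ)
        (-(((m : ℂ) + 1) * DoubleTwist.S (m : ℤ) (DoubleTwist.yTrace ρ) ^ 2)) (-3)
        (((m : ℂ) + 1) * DoubleTwist.S (m : ℤ) (DoubleTwist.yTrace ρ) ^ 2) (6 * n)) := by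
  open DoubleTwist in
  obtain ⟨N, hN⟩ : ∃ N : ℕ, n = -(N + 1 : ℕ) := ⟨(-n - 1).toNat, by omega⟩
  have habs : |n| = (N + 1 : ℕ) := by rw [hN, abs_neg, Nat.abs_cast]
  refine ⟨fun m hm => ?_, fun m hm => ?_⟩
  · subst hm
    have hy := S_yTrace_ne_zero_even (m := m) hρ.ne
    have hz := S_zTrace_ne_zero hN hρ.ne
    have hm : m ≠ 0 := by
      rintro rfl
      exact hy (by simp [S])
    rw [habs, Int.cast_natCast]
    refine hρ.hasExtremeTerms_even hN ?_ rfl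
    exact mul_ne_zero (mul_ne_zero (mul_ne_zero (Nat.cast_ne_zero.2 hm)
      (Nat.cast_ne_zero.2 N.succ_ne_zero)) (pow_ne_zero 2 hy)) (pow_ne_zero 2 hz)
  · subst hm
    exact hρ.hasExtremeTerms_odd hN (mul_ne_zero (Nat.cast_add_one_ne_zero m)
      (pow_ne_zero 2 (hρ.S_yTrace_ne_zero_odd hN))) rfl

theorem proposition3p7 (k : ℕ) (hk : 1 ≤ k) (n : ℤ) (hn : n ≤ -1)
    (ρ : DoubleTwist.KnotGroup k n →* Matrix.SpecialLinearGroup (Fin 2) ℂ)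
    (hρ : DoubleTwist.IsHolonomy ρ ∨ (k = 1 ∧ DoubleTwist.IsNonabelianParabolic ρ)) :
    (∀ m : ℕ, k = 2 * m →
      DoubleTwist.HasExtremeTerms (DoubleTwist.adjointTwistedAlexander ρ)
        ((m : ℂ) * ((|n| : ℤ) : ℂ) * DoubleTwist.S ((m : ℤ) - 1) (DoubleTwist.yTrace ρ) ^ 2 *
          DoubleTwist.S (|n| - 1) (DoubleTwist.zTrace ρ) ^ 2) 0
        (-((m : ℂ) * ((|n| : ℤ) : ℂ) * DoubleTwist.S ((m : ℤ) - 1) (DoubleTwist.yTrace ρ) ^ 2 *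
          DoubleTwist.S (|n| - 1) (DoubleTwist.zTrace ρ) ^ 2)) (-3)) ∧
    (∀ m : ℕ, k = 2 * m + 1 →
      DoubleTwist.HasExtremeTerms (DoubleTwist.adjointTwistedAlexander ρ)
        (-(((m : ℂ) + 1) * DoubleTwist.S (m : ℤ) (DoubleTwist.yTrace ρ) ^ 2)) (-3)
        (((m : ℂ) + 1) * DoubleTwist.S (m : ℤ) (DoubleTwist.yTrace ρ) ^ 2) (6 * n)) := by
  exact proposition3p7_general k n hn ρ
    (hρ.elim (·.isNonabelianParabolic (by omega) (by omega)) And.right)
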